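/- For $n\ge 1$ let $B_n$ be the braid group on $n$ strands, given by its Artin presentation, and let $PB_n$ be the pure braid group, i.e. the kernel of the natural epimorphism $B_n\to S_n$. The pure braided Thompson group $F_{br}$ consists of the equivalence classes $[T_-,p,T_+]$ of triples $(T_-,p,T_+)$, where $T_-$ and $T_+$ are finite rooted binary trees with the same number $n$ of leaves and $p\in PB_n$. Here the equivalence relation is generated by identifying $(T_-,p,T_+)$ with each of its expansions $(T_-',p',T_+')$, where $T_\pm'$ is obtained from $T_\pm$ by adding a caret to the $k$th leaf (for some $1\le k\le n$) and $p'$ is obtained from $p$ by bifurcating the $k$th strand into two parallel strands. The group operation is determined by $[T,p,U][U,q,W]=[T,pq,W]$ (any two elements can be brought into this form by expansions). Vertices of binary trees are addressed by words in $\{0,1\}^*$: the root has the empty word as its address, and the left (respectively right) child of the vertex with address $u$ has address $u0$ (respectively $u1$). For $w\in\{0,1\}^*$, the vine $V(w)$ is the unique tree with $|w|+1$ leaves that has a leaf with address $w$. A tree is called $w$-deferred if the address of each of its leaves either has $w$ as a prefix or is the address of a leaf of $V(w)$. Let $F_{br}(w)\le F_{br}$ be the subgroup of all elements $[T_-,p,T_+]$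 such that $T_-$ and $T_+$ are $w$-deferred. Theorem. For every $w\in\{0,1\}^*$ of length at least $3$, the group $F_{br}(w)$ is not isomorphic to $F_{br}$, nor to any quotient of $F_{br}$ by a normal subgroup. -/

import Mathlib

namespace BraidedThompson

/-! ### Braid groups -/

/-- The relators of the Artin presentation of the braid group on `n` strands. The generator
`s_{i+1}` of the usual numbering from `1` is the generator of index `i : Fin (n - 1)`. -/
def braidRels (n : ℕ) : Set (FreeGroup (Fin (n - 1))) :=
  {r | ∃ i j : Fin (n - 1), i.1 + 1 < j.1 ∧
      r = (FreeGroup.of i * FreeGroup.of j) * (FreeGroup.of j * FreeGroup.of i)⁻¹} ∪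
  {r | ∃ i j : Fin (n - 1), i.1 + 1 = j.1 ∧
      r = (FreeGroup.of i * FreeGroup.of j * FreeGroup.of i) *
        (FreeGroup.of j * FreeGroup.of i * FreeGroup.of j)⁻¹}

/-- The braid group on `n` strands. -/
abbrev Braid (n : ℕ) : Type := PresentedGroup (braidRels n)

/-- The standard generator crossing the strands in positions `i` and `i + 1` (counted from `0`),
for `i + 1 < n`; the value outside this range is `1` and is never used. -/
def s (n i : ℕ) : Braid n :=
  if h : i < n - 1 then PresentedGroup.of ⟨i, h⟩ else 1

theorem s_fin {n : ℕ} (i : Fin (n - 1)) : s n i = PresentedGroup.of i := by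
  simp [s]

theorem s_comm (n : ℕ) {i j : ℕ} (h : i + 1 < j) : s n i * s n j = s n j * s n i := by
  unfold s
  split_ifs with hi hj
  · exact PresentedGroup.mk_eq_mk_of_mul_inv_mem (Or.inl ⟨⟨i, hi⟩, ⟨j, hj⟩, h, rfl⟩)
  all_goals simp

theorem s_braid {n i : ℕ} (h : i + 2 < n) :
    s n i * s n (i + 1) * s n i = s n (i + 1) * s n i * s n (i + 1) := by
  unfold s
  rw [dif_pos (by omega), dif_pos (by omega)]
  exact PresentedGroup.mk_eq_mk_of_mul_inv_mem
    (Or.inr ⟨⟨i, by omega⟩, ⟨i + 1, by omega⟩, rfl, rfl⟩)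

theorem lift_rels {n : ℕ} {G : Type*} [Group G] (f : Fin (n - 1) → G)
    (hc : ∀ i j, i.1 + 1 < j.1 → f i * f j = f j * f i)
    (hb : ∀ i j, i.1 + 1 = j.1 → f i * f j * f i = f j * f i * f j) :
    ∀ r ∈ braidRels n, FreeGroup.lift f r = 1 := by
  rintro r (⟨i, j, h, rfl⟩ | ⟨i, j, h, rfl⟩)
  · simp only [map_mul, map_inv, FreeGroup.lift_apply_of, mul_inv_eq_one]
    exact hc i j h
  · simp only [map_mul, map_inv, FreeGroup.lift_apply_of, mul_inv_eq_one]
    exact hb i j h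

theorem braid_induction {n : ℕ} {C : Braid n → Prop} (b : Braid n)
    (hs : ∀ i, i + 1 < n → C (s n i)) (h1 : C 1) (hm : ∀ a b, C a → C b → C (a * b))
    (hi : ∀ a, C a → C a⁻¹) : C b := by
  have hb : b ∈ Subgroup.closure (Set.range (PresentedGroup.of (rels := braidRels n))) := by
    rw [PresentedGroup.closure_range_of]; trivial
  induction hb using Subgroup.closure_induction with
  | mem x hx =>
    obtain ⟨i, rfl⟩ := hx
    rw [← s_fin]
    exact hs i (by omega)
  | one => exact h1
  | mul a b _ _ ha hb => exact hm a b ha hb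
  | inv a _ ha => exact hi a ha

/-- The transposition of `i` and `i + 1`, as a function on natural numbers. -/
def posSwap (i k : ℕ) : ℕ := if k = i then i + 1 else if k = i + 1 then i else k

theorem posSwap_comm {i j : ℕ} (h : i + 1 < j) (k : ℕ) :
    posSwap i (posSwap j k) = posSwap j (posSwap i k) := by
  unfold posSwap
  split_ifs <;> omega

theorem posSwap_braid (i k : ℕ) :
    posSwap i (posSwap (i + 1) (posSwap i k)) =
      posSwap (i + 1) (posSwap i (posSwap (i + 1) k)) := by
  unfold posSwap
  obtain rfl | rfl | rfl | hk :
      k = i ∨ k = i + 1 ∨ k = i + 2 ∨ (k ≠ i ∧ k ≠ i + 1 ∧ k ≠ i + 2) := by omega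
  · grind
  · grind
  · grind
  · simp [hk]

/-- The transposition of the positions `i` and `i + 1`. -/
def adjSwap {n : ℕ} (i : Fin (n - 1)) : Equiv.Perm (Fin n) :=
  Equiv.swap ⟨i, by omega⟩ ⟨i + 1, by omega⟩

theorem adjSwap_val {n : ℕ} (i : Fin (n - 1)) (k : Fin n) :
    (adjSwap i k).1 = posSwap i k := by
  unfold adjSwap posSwap
  rw [Equiv.swap_apply_def]
  simp only [Fin.ext_iff]
  split_ifs <;> rfl

/-- The natural epimorphism from the braid group onto the symmetric group. If `strandPerm n b`
sends `i` to `j`, then the strand of `b` in position `i` at the bottom is in position `j`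
at the top. -/
def strandPerm (n : ℕ) : Braid n →* Equiv.Perm (Fin n) :=
  PresentedGroup.toGroup (f := adjSwap) (lift_rels _
    (by
      intro i j h
      ext k
      simp only [Equiv.Perm.mul_apply, adjSwap_val]
      exact posSwap_comm h _)
    (by
      intro i j h
      ext k
      simp only [Equiv.Perm.mul_apply, adjSwap_val, ← h]
      exact posSwap_braid _ _))

theorem strandPerm_s {n i : ℕ} (h : i + 1 < n) :
    strandPerm n (s n i) = adjSwap ⟨i, by omega⟩ := by
  unfold s
  rw [dif_pos (by omega)]
  exact PresentedGroup.toGroup.of _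

theorem strandPerm_s_val {n i : ℕ} (h : i + 1 < n) (k : Fin n) :
    (strandPerm n (s n i) k).1 = posSwap i k := by
  rw [strandPerm_s h, adjSwap_val]

/-- The pure braid group on `n` strands. -/
abbrev PureBraid (n : ℕ) : Subgroup (Braid n) := (strandPerm n).ker

/-! ### Bifurcating a strand -/

/-- The braid on `n + 1` strands obtained from the generator `s n i` by bifurcating the strand
in position `k`, counted at the bottom, into two parallel strands. In a product the left factor
is drawn above the right one. -/
def bifurcateGen (n i k : ℕ) : Braid (n + 1) :=
  if k < i then s (n + 1) (i + 1)
  else if k = i then s (n + 1) i * s (n + 1) (i + 1)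
  else if k = i + 1 then s (n + 1) (i + 1) * s (n + 1) i
  else s (n + 1) i

theorem bifurcateGen_comm (n : ℕ) {i j : ℕ} (h : i + 1 < j) (k : ℕ) :
    bifurcateGen n i (posSwap j k) * bifurcateGen n j k =
      bifurcateGen n j (posSwap i k) * bifurcateGen n i k := by
  have h1 := s_comm (n + 1) (i := i) (j := j) (by omega)
  have h2 := s_comm (n + 1) (i := i + 1) (j := j + 1) (by omega)
  have h3 := s_comm (n + 1) (i := i) (j := j + 1) (by omega)
  unfold bifurcateGen posSwap
  generalize s (n + 1) i = a at *
  generalize s (n + 1) (i + 1) = b at *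
  generalize s (n + 1) j = c at *
  generalize s (n + 1) (j + 1) = d at *
  have hac : Commute a c := h1
  have hbd : Commute b d := h2
  have had : Commute a d := h3
  split_ifs <;> first
    | omega
    | exact h1
    | exact h2
    | exact h3
    | exact (hac.mul_right had).eq
    | exact (had.mul_right hac).eq
    | exact (had.mul_left hbd).eq
    | exact (hbd.mul_left had).eq

theorem bifurcateGen_braid {n i : ℕ} (h : i + 2 < n) (k : ℕ) :
    bifurcateGen n i (posSwap (i + 1) (posSwap i k)) *
      (bifurcateGen n (i + 1) (posSwap i k) * bifurcateGen n i k) =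
    bifurcateGen n (i + 1) (posSwap i (posSwap (i + 1) k)) *
      (bifurcateGen n i (posSwap (i + 1) k) * bifurcateGen n (i + 1) k) := by
  have h1 := s_braid (n := n + 1) (i := i) (by omega)
  have h2 := s_braid (n := n + 1) (i := i + 1) (by omega)
  have h3 := s_comm (n + 1) (i := i) (j := i + 2) (by omega)
  simp only [add_assoc, Nat.reduceAdd] at h2
  unfold bifurcateGen posSwap
  simp only [add_assoc, Nat.reduceAdd]
  generalize s (n + 1) i = a at *
  generalize s (n + 1) (i + 1) = b at *
  generalize s (n + 1) (i + 2) = c at *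
  obtain hk | hk | hk | hk | hk :
      k < i ∨ k = i ∨ k = i + 1 ∨ k = i + 2 ∨ i + 2 < k := by omega
  · simp [show k ≠ i by omega, show k ≠ i + 1 by omega, show k ≠ i + 2 by omega, hk,
      show k < i + 1 by omega]
    simpa [mul_assoc] using h2
  · subst hk
    simp
    calc a * (b * c * (a * b)) = a * b * (c * a) * b := by simp only [mul_assoc]
      _ = (a * b * a) * c * b := by rw [← h3]; simp only [mul_assoc]
      _ = b * a * (b * c * b) := by rw [h1]; simp only [mul_assoc]
      _ = b * (a * c) * b * c := by rw [h2]; simp only [mul_assoc]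
      _ = b * c * (a * b * c) := by rw [h3]; simp only [mul_assoc]
  · subst hk
    simp
    calc a * b * (c * (b * a)) = a * (b * c * b) * a := by simp only [mul_assoc]
      _ = (a * c) * b * (c * a) := by rw [h2]; simp only [mul_assoc]
      _ = (c * a) * b * (c * a) := by rw [h3]
      _ = (c * a) * b * (a * c) := by rw [h3]
      _ = c * (a * b * a) * c := by simp only [mul_assoc]
      _ = c * b * (a * (b * c)) := by rw [h1]; simp only [mul_assoc]
  · subst hk
    simp
    calc b * a * (c * b * a) = b * (a * c) * b * a := by simp only [mul_assoc]
      _ = (b * c) * (a * b * a) := by rw [h3]; simp only [mul_assoc]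
      _ = (b * c * b) * a * b := by rw [h1]; simp only [mul_assoc]
      _ = c * b * (c * a) * b := by rw [h2]; simp only [mul_assoc]
      _ = c * (b * a * (c * b)) := by rw [← h3]; simp only [mul_assoc]
  · simp [show k ≠ i by omega, show k ≠ i + 1 by omega, show k ≠ i + 2 by omega,
      show ¬ k < i by omega, show ¬ k < i + 1 by omega]
    simpa [mul_assoc] using h1

/-- The permutation `(k, g) ↦ (adjSwap i k, bifurcateGen n i k * g)`. -/
def bifurcateAux {n : ℕ} (i : Fin (n - 1)) : Equiv.Perm (Fin n × Braid (n + 1)) where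
  toFun x := (adjSwap i x.1, bifurcateGen n i x.1 * x.2)
  invFun x := (adjSwap i x.1, (bifurcateGen n i (adjSwap i x.1))⁻¹ * x.2)
  left_inv x := by simp [adjSwap]
  right_inv x := by simp [adjSwap]

/-- The braid group on `n` strands acts on pairs `(k, g)` by
`b • (k, g) = (strandPerm n b k, bifurcate k b * g)`, see `bifurcateHom_apply`. -/
def bifurcateHom (n : ℕ) : Braid n →* Equiv.Perm (Fin n × Braid (n + 1)) :=
  PresentedGroup.toGroup (f := bifurcateAux) (lift_rels _
    (by
      intro i j h
      ext x : 1
      refine Prod.ext (Fin.ext ?_) ?_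
      · simp only [Equiv.Perm.mul_apply, bifurcateAux, Equiv.coe_fn_mk, adjSwap_val]
        exact posSwap_comm h _
      · simp only [Equiv.Perm.mul_apply, bifurcateAux, Equiv.coe_fn_mk, adjSwap_val, ← mul_assoc]
        rw [bifurcateGen_comm n h])
    (by
      intro i j h
      ext x : 1
      refine Prod.ext (Fin.ext ?_) ?_
      · simp only [Equiv.Perm.mul_apply, bifurcateAux, Equiv.coe_fn_mk, adjSwap_val, ← h]
        exact posSwap_braid _ _
      · have := congrArg (· * x.2) (bifurcateGen_braid (n := n) (i := i) (by omega) x.1)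
        simp only [mul_assoc] at this
        simpa only [Equiv.Perm.mul_apply, bifurcateAux, Equiv.coe_fn_mk, adjSwap_val, ← h]
          using this))

/-- `bifurcate k b` is the braid obtained from `b` by bifurcating the strand in position `k`,
counted at the bottom, into two parallel strands. It is determined by its values on the generators
(`bifurcate_s`) and on products (`bifurcate_mul`). -/
def bifurcate {n : ℕ} (k : Fin n) (b : Braid n) : Braid (n + 1) :=
  (bifurcateHom n b (k, 1)).2

theorem bifurcateHom_s {n i : ℕ} (h : i + 1 < n) (x : Fin n × Braid (n + 1)) :
    bifurcateHom n (s n i) x = (strandPerm n (s n i) x.1, bifurcateGen n i x.1 * x.2) := by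
  rw [strandPerm_s h]
  unfold s
  rw [dif_pos (by omega)]
  simp only [bifurcateHom, PresentedGroup.toGroup.of]
  rfl

theorem bifurcateHom_apply {n : ℕ} (b : Braid n) (k : Fin n) (g : Braid (n + 1)) :
    bifurcateHom n b (k, g) = (strandPerm n b k, bifurcate k b * g) := by
  suffices H : ∀ k g, ((bifurcateHom n b (k, g)).1 = strandPerm n b k) ∧
      ∀ g', (bifurcateHom n b (k, g * g')).2 = (bifurcateHom n b (k, g)).2 * g' by
    refine Prod.ext (H k g).1 ?_
    simpa [bifurcate] using (H k 1).2 g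
  induction b using braid_induction with
  | hs i hi => intro k g; simp [bifurcateHom_s hi, mul_assoc]
  | h1 => simp
  | hm a b ha hb =>
    intro k g
    simp only [map_mul, Equiv.Perm.mul_apply]
    refine ⟨?_, fun g' => ?_⟩
    · rw [← (hb k g).1]
      exact (ha _ _).1
    · have e : bifurcateHom n b (k, g * g') =
          ((bifurcateHom n b (k, g)).1, (bifurcateHom n b (k, g)).2 * g') :=
        Prod.ext (by rw [(hb _ _).1, (hb _ _).1]) ((hb k g).2 g')
      rw [e, (ha _ _).2]
  | hi a ha =>
    intro k g
    have e : ∀ g, (bifurcateHom n a)⁻¹ (k, g) = ((strandPerm n a)⁻¹ k,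
        (bifurcateHom n a ((strandPerm n a)⁻¹ k, 1)).2⁻¹ * g) := by
      intro g
      rw [Equiv.Perm.inv_eq_iff_eq]
      refine Prod.ext ?_ ?_
      · rw [(ha _ _).1]; simp
      · have := (ha ((strandPerm n a)⁻¹ k) 1).2
          ((bifurcateHom n a ((strandPerm n a)⁻¹ k, 1)).2⁻¹ * g)
        rw [one_mul] at this
        rw [this]; simp
    simp only [map_inv, e]
    exact ⟨trivial, fun g' => by rw [mul_assoc]⟩

theorem bifurcate_s {n i : ℕ} (h : i + 1 < n) (k : Fin n) :
    bifurcate k (s n i) = bifurcateGen n i k := by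
  simp [bifurcate, bifurcateHom_s h]

theorem bifurcate_one {n : ℕ} (k : Fin n) : bifurcate k (1 : Braid n) = 1 := by
  simp [bifurcate]

theorem bifurcate_mul {n : ℕ} (k : Fin n) (b c : Braid n) :
    bifurcate k (b * c) = bifurcate (strandPerm n c k) b * bifurcate k c := by
  rw [bifurcate, map_mul, Equiv.Perm.mul_apply, bifurcateHom_apply, bifurcateHom_apply]
  simp

theorem bifurcate_inv {n : ℕ} (k : Fin n) (b : Braid n) :
    bifurcate k b⁻¹ = (bifurcate ((strandPerm n b)⁻¹ k) b)⁻¹ := by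
  rw [eq_inv_iff_mul_eq_one]
  have := bifurcate_mul ((strandPerm n b)⁻¹ k) b⁻¹ b
  simpa [bifurcate_one] using this.symm

/-- How the strands not being bifurcated are permuted. -/
theorem strandPerm_bifurcate {n : ℕ} (b : Braid n) : ∀ j k : Fin n,
    strandPerm (n + 1) (bifurcate j b) (j.castSucc.succAbove k) =
      (strandPerm n b j).castSucc.succAbove (strandPerm n b k) := by
  induction b using braid_induction with
  | hs i hi =>
    intro j k
    rw [bifurcate_s hi]
    ext
    have v0 := strandPerm_s_val (n := n + 1) (i := i) (by omega)
    have v1 := strandPerm_s_val (n := n + 1) (i := i + 1) (by omega)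
    have e (j k : Fin n) : (j.castSucc.succAbove k).1 = if k.1 < j.1 then k.1 else k.1 + 1 := by
      simp only [Fin.succAbove, Fin.lt_def, Fin.val_castSucc]
      split_ifs <;> simp
    unfold bifurcateGen
    split_ifs <;> simp only [map_mul, Equiv.Perm.mul_apply, v0, v1, e, strandPerm_s_val hi] <;>
      unfold posSwap <;> grind
  | h1 => intro j k; simp [bifurcate_one]
  | hm a b ha hb =>
    intro j k
    rw [bifurcate_mul, map_mul, Equiv.Perm.mul_apply, hb, ha, map_mul, Equiv.Perm.mul_apply,
      Equiv.Perm.mul_apply]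
  | hi a ha =>
    intro j k
    rw [bifurcate_inv, map_inv, Equiv.Perm.inv_eq_iff_eq, map_inv, ha]
    simp

/-- Bifurcating two different strands can be done in either order. -/
theorem bifurcate_bifurcate {n : ℕ} (b : Braid n) : ∀ j k : Fin n, j < k →
    bifurcate k.succ (bifurcate j b) = bifurcate j.castSucc (bifurcate k b) := by
  suffices H : ∀ j k : Fin n, j ≠ k → bifurcate (j.castSucc.succAbove k) (bifurcate j b) =
      bifurcate (k.castSucc.succAbove j) (bifurcate k b) by
    intro j k h
    have := H j k h.ne
    rwa [Fin.succAbove_of_le_castSucc _ _ (Fin.castSucc_le_castSucc_iff.2 h.le),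
      Fin.succAbove_of_castSucc_lt _ _ (Fin.castSucc_lt_castSucc_iff.2 h)] at this
  induction b using braid_induction with
  | hs i hi =>
    suffices H : ∀ j k : Fin n, j < k → bifurcate (j.castSucc.succAbove k) (bifurcate j (s n i)) =
        bifurcate (k.castSucc.succAbove j) (bifurcate k (s n i)) by
      intro j k h
      rcases lt_or_gt_of_ne h with h | h
      · exact H j k h
      · exact (H k j h).symm
    intro j k h
    rw [Fin.succAbove_of_le_castSucc _ _ (Fin.castSucc_le_castSucc_iff.2 h.le),
      Fin.succAbove_of_castSucc_lt _ _ (Fin.castSucc_lt_castSucc_iff.2 h), bifurcate_s hi,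
      bifurcate_s hi]
    rw [Fin.lt_def] at h
    have h3 : ∀ x, s (n + 1 + 1) i * (s (n + 1 + 1) (i + 1 + 1) * x) =
        s (n + 1 + 1) (i + 1 + 1) * (s (n + 1 + 1) i * x) := fun x => by
      rw [← mul_assoc, s_comm _ (by omega), mul_assoc]
    have e0 : ∀ k, bifurcate k (s (n + 1) i) = bifurcateGen (n + 1) i k :=
      bifurcate_s (n := n + 1) (i := i) (by omega)
    have e1 : ∀ k, bifurcate k (s (n + 1) (i + 1)) = bifurcateGen (n + 1) (i + 1) k :=
      bifurcate_s (n := n + 1) (i := i + 1) (by omega)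
    have v0 := strandPerm_s_val (n := n + 1) (i := i) (by omega)
    have v1 := strandPerm_s_val (n := n + 1) (i := i + 1) (by omega)
    obtain hj | hj | hj | hj : j.1 < i ∨ j.1 = i ∨ j.1 = i + 1 ∨ i + 1 < j.1 := by omega
    all_goals
      obtain hk | hk | hk | hk : k.1 < i ∨ k.1 = i ∨ k.1 = i + 1 ∨ i + 1 < k.1 := by omega
    all_goals first
      | omega
      | (simp (disch := omega) only [bifurcateGen, posSwap, if_pos, if_neg, bifurcate_mul, e0, e1,
          v0, v1, Fin.val_succ, Fin.val_castSucc, if_true, mul_assoc]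
         try rw [h3])
  | h1 => intro j k _; simp [bifurcate_one]
  | hm a b ha hb =>
    intro j k h
    rw [bifurcate_mul, bifurcate_mul, bifurcate_mul, bifurcate_mul, hb j k h,
      strandPerm_bifurcate, strandPerm_bifurcate, ha _ _ (by simpa using h)]
  | hi a ha =>
    intro j k h
    have e : ∀ j k, (strandPerm (n + 1) (bifurcate ((strandPerm n a)⁻¹ j) a))⁻¹
        (j.castSucc.succAbove k) = ((strandPerm n a)⁻¹ j).castSucc.succAbove
          ((strandPerm n a)⁻¹ k) := by
      intro j k
      rw [Equiv.Perm.inv_eq_iff_eq, strandPerm_bifurcate]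
      simp
    rw [bifurcate_inv, bifurcate_inv, bifurcate_inv, bifurcate_inv, e, e,
      ha _ _ (by simpa using h)]

theorem bifurcate_mem {n : ℕ} (k : Fin n) {p : Braid n} (hp : p ∈ PureBraid n) :
    bifurcate k p ∈ PureBraid (n + 1) := by
  rw [MonoidHom.mem_ker] at hp ⊢
  have H := strandPerm_bifurcate p k
  simp only [hp, Equiv.Perm.one_apply] at H
  have H' : ∀ i, i ≠ k.castSucc → strandPerm (n + 1) (bifurcate k p) i = i := by
    intro i hi
    obtain ⟨l, rfl⟩ := Fin.exists_succAbove_eq hi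
    exact H l
  ext i : 1
  by_cases hi : i = k.castSucc
  · subst hi
    by_contra hne
    exact hne ((strandPerm (n + 1) (bifurcate k p)).injective (H' _ hne))
  · exact H' i hi

/-- Bifurcating the strand in position `k` of pure braids. -/
def bifurcatePure {n : ℕ} (k : Fin n) : PureBraid n →* PureBraid (n + 1) where
  toFun p := ⟨bifurcate k p, bifurcate_mem k p.2⟩
  map_one' := Subtype.ext (bifurcate_one k)
  map_mul' p q := Subtype.ext (by
    have hq : strandPerm n q = 1 := q.2
    simp [bifurcate_mul, hq])

theorem bifurcatePure_comm {n : ℕ} (p : PureBraid n) {j k : Fin n} (h : j < k) :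
    bifurcatePure k.succ (bifurcatePure j p) = bifurcatePure j.castSucc (bifurcatePure k p) :=
  Subtype.ext (bifurcate_bifurcate p.1 j k h)


/-! ### Trees -/

/-- Finite rooted binary trees. -/
abbrev BTree : Type := BinaryTree Unit

namespace BTree

open BinaryTree (nil node numLeaves)

/-- Adding a caret to the leaf in position `k`, counted from `0` from the left, for
`k < T.numLeaves`. -/
def addCaret : BTree → ℕ → BTree
  | nil, _ => node () nil nil
  | node _ l r, k =>
      if k < l.numLeaves then node () (addCaret l k) r else node () l (addCaret r (k - l.numLeaves))

theorem numLeaves_pos (T : BTree) : 0 < T.numLeaves := by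
  induction T with
  | nil => simp
  | node _ l r hl hr => simp; omega

theorem numLeaves_addCaret (T : BTree) (k : ℕ) : (T.addCaret k).numLeaves = T.numLeaves + 1 := by
  induction T generalizing k with
  | nil => rfl
  | node _ l r hl hr =>
    unfold addCaret
    split_ifs
    · simp [hl]; omega
    · simp [hr]; omega

theorem addCaret_comm (T : BTree) {j k : ℕ} (h : j < k) (hk : k < T.numLeaves) :
    (T.addCaret j).addCaret (k + 1) = (T.addCaret k).addCaret j := by
  induction T generalizing j k with
  | nil => simp at hk; omega
  | node _ l r hl hr =>
    have := numLeaves_addCaret l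
    simp only [numLeaves] at hk
    by_cases h1 : j < l.numLeaves <;> by_cases h2 : k < l.numLeaves
    · simp [addCaret, h1, h2, this, hl h h2, show j < l.numLeaves + 1 by omega]
    · simp [addCaret, h1, h2, this]
    · omega
    · simp [addCaret, h1, h2, show ¬ k + 1 < l.numLeaves by omega,
        ← hr (j := j - l.numLeaves) (k := k - l.numLeaves) (by omega) (by omega),
        Nat.sub_add_comm (Nat.le_of_not_lt h2)]

/-- `S` can be obtained from `T` by adding carets. -/
def Refines : BTree → BTree → Prop
  | nil, _ => True
  | node _ _ _, nil => False
  | node _ l r, node _ l' r' => Refines l l' ∧ Refines r r'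

theorem Refines.refl (T : BTree) : Refines T T := by
  induction T with
  | nil => trivial
  | node _ l r hl hr => exact ⟨hl, hr⟩

theorem Refines.numLeaves_le {T S : BTree} (h : Refines T S) : T.numLeaves ≤ S.numLeaves := by
  induction T generalizing S with
  | nil => exact numLeaves_pos S
  | node _ l r hl hr =>
    cases S with
    | nil => exact h.elim
    | node _ l' r' =>
      have h1 := hl h.1
      have h2 := hr h.2
      simp only [numLeaves]
      omega

theorem Refines.of_addCaret {T S : BTree} {k : ℕ} (h : Refines (T.addCaret k) S) :
    Refines T S := by
  induction T generalizing S k with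
  | nil => trivial
  | node _ l r hl hr =>
    unfold addCaret at h
    cases S with
    | nil => split_ifs at h <;> exact h.elim
    | node _ l' r' =>
      split_ifs at h
      · exact ⟨hl h.1, h.2⟩
      · exact ⟨h.1, hr h.2⟩

theorem Refines.addCaret_addCaret {T S : BTree} {j k : ℕ} (hjk : j < k) (hk : k < T.numLeaves)
    (hj : Refines (T.addCaret j) S) (h : Refines (T.addCaret k) S) :
    Refines ((T.addCaret j).addCaret (k + 1)) S := by
  induction T generalizing S j k with
  | nil => simp at hk; omega
  | node _ l r hl hr =>
    have := numLeaves_addCaret l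
    simp only [numLeaves] at hk
    cases S with
    | nil => unfold addCaret at h; split_ifs at h <;> exact h.elim
    | node _ l' r' =>
      by_cases h1 : j < l.numLeaves <;> by_cases h2 : k < l.numLeaves
      · simp only [addCaret, h1, h2, this, if_true, Refines, Nat.add_lt_add_iff_right] at hj h ⊢
        exact ⟨hl hjk h2 hj.1 h.1, h.2⟩
      · simp only [addCaret, h1, h2, this, if_true, if_false, Refines,
          Nat.add_lt_add_iff_right, Nat.add_sub_add_right] at hj h ⊢
        exact ⟨hj.1, h.2⟩
      · omega
      · simp only [addCaret, h1, h2, if_false, Refines,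
          show ¬ k + 1 < l.numLeaves by omega,
          Nat.sub_add_comm (Nat.le_of_not_lt h2)] at hj h ⊢
        exact ⟨h.1, hr (by omega) (by omega) hj.2 h.2⟩

theorem Refines.eq_or_exists {T S : BTree} (h : Refines T S) :
    T = S ∨ ∃ k < T.numLeaves, Refines (T.addCaret k) S := by
  induction T generalizing S with
  | nil =>
    cases S with
    | nil => exact Or.inl rfl
    | node _ l' r' => exact Or.inr ⟨0, by simp, trivial, trivial⟩
  | node _ l r hl hr =>
    cases S with
    | nil => exact h.elim
    | node _ l' r' =>
      rcases hl h.1 with rfl | ⟨k, hk, h'⟩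
      · rcases hr h.2 with rfl | ⟨k, hk, h'⟩
        · exact Or.inl rfl
        · refine Or.inr ⟨l.numLeaves + k, by simpa using hk, ?_⟩
          simp [addCaret, Refines, h', Refines.refl]
      · refine Or.inr ⟨k, by simp; omega, ?_⟩
        simp only [addCaret, hk, if_true]
        exact ⟨h', h.2⟩

theorem exists_refines (T S : BTree) : ∃ R, Refines T R ∧ Refines S R := by
  induction T generalizing S with
  | nil => exact ⟨S, trivial, Refines.refl S⟩
  | node _ l r hl hr =>
    cases S with
    | nil => exact ⟨node () l r, Refines.refl _, trivial⟩
    | node _ l' r' =>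
      obtain ⟨R, h1, h2⟩ := hl l'
      obtain ⟨R', h1', h2'⟩ := hr r'
      exact ⟨node () R R', ⟨h1, h1'⟩, ⟨h2, h2'⟩⟩

/-- The addresses of the leaves of a tree, from left to right: `false` stands for the letter `0`
(left child) and `true` for the letter `1` (right child). -/
def leafAddresses : BTree → List (List Bool)
  | nil => [[]]
  | node _ l r => (leafAddresses l).map (List.cons false) ++ (leafAddresses r).map (List.cons true)

/-- The vine to `w`: the unique tree with `w.length + 1` leaves that has a leaf with
address `w`. -/
def vine : List Bool → BTree
  | [] => nil
  | false :: w => node () (vine w) nil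
  | true :: w => node () nil (vine w)

theorem numLeaves_vine (w : List Bool) : (vine w).numLeaves = w.length + 1 := by
  induction w with
  | nil => rfl
  | cons a w ih => cases a <;> simp [vine, ih]; omega

theorem mem_leafAddresses_vine (w : List Bool) : w ∈ (vine w).leafAddresses := by
  induction w with
  | nil => simp [vine, leafAddresses]
  | cons a w ih => cases a <;> simp [vine, leafAddresses, ih]

theorem length_lt_numLeaves {T : BTree} {w : List Bool} (hw : w ∈ T.leafAddresses) :
    w.length < T.numLeaves := by
  induction T generalizing w with
  | nil => simp_all [leafAddresses]
  | node _ l r hl hr =>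
    have := numLeaves_pos l
    have := numLeaves_pos r
    simp only [leafAddresses, List.mem_append, List.mem_map] at hw
    rcases hw with ⟨v, hv, rfl⟩ | ⟨v, hv, rfl⟩
    · have := hl hv; simp; omega
    · have := hr hv; simp; omega

theorem eq_vine {T : BTree} {w : List Bool} (hw : w ∈ T.leafAddresses)
    (hT : T.numLeaves = w.length + 1) : T = vine w := by
  induction T generalizing w with
  | nil => simp_all [leafAddresses, vine]
  | node _ l r hl hr =>
    have hone : ∀ S : BTree, S.numLeaves ≤ 1 → S = nil := by
      intro S hS
      cases S with
      | nil => rfl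
      | node _ l r =>
        have := numLeaves_pos l
        have := numLeaves_pos r
        simp at hS; omega
    have h1 := numLeaves_pos l
    have h2 := numLeaves_pos r
    simp only [numLeaves] at hT
    simp only [leafAddresses, List.mem_append, List.mem_map] at hw
    rcases hw with ⟨v, hv, rfl⟩ | ⟨v, hv, rfl⟩
    · have := length_lt_numLeaves hv
      simp only [List.length_cons] at hT
      rw [vine, ← hl hv (by omega), hone r (by omega)]
    · have := length_lt_numLeaves hv
      simp only [List.length_cons] at hT
      rw [vine, ← hr hv (by omega), hone l (by omega)]

/-- A tree is `w`-deferred if every address of a leaf of it either has `w` as a prefix or is the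
address of a leaf of the vine to `w`. -/
def IsDeferred (w : List Bool) (T : BTree) : Prop :=
  ∀ a ∈ T.leafAddresses, w <+: a ∨ a ∈ (vine w).leafAddresses

/-- The tree obtained from the vine to `w` by attaching `A` to the leaf with address `w`. -/
def graft : List Bool → BTree → BTree
  | [], A => A
  | false :: w, A => node () (graft w A) nil
  | true :: w, A => node () nil (graft w A)

theorem isDeferred_iff {w : List Bool} {T : BTree} : IsDeferred w T ↔ ∃ A, T = graft w A := by
  have hnil : ∀ T : BTree, ([] : List Bool) ∈ T.leafAddresses → T = nil := by
    intro T hT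
    cases T with
    | nil => rfl
    | node _ l r => simp [leafAddresses] at hT
  have hne : ∀ T : BTree, T.leafAddresses ≠ [] := by
    intro T
    induction T with
    | nil => simp [leafAddresses]
    | node _ l r hl hr => simp [leafAddresses, hl]
  have hnil' : ∀ T : BTree, (∀ a ∈ T.leafAddresses, a = []) → T = nil := by
    intro T hT
    obtain ⟨a, ha⟩ := List.exists_mem_of_ne_nil _ (hne T)
    exact hnil T (hT a ha ▸ ha)
  constructor
  · intro h
    induction w generalizing T with
    | nil => exact ⟨T, rfl⟩
    | cons b w ih =>
      cases T with
      | nil =>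
        have := h [] (by simp [leafAddresses])
        cases b <;> simp [vine, leafAddresses] at this
      | node _ l r =>
        cases b
        · have hl : IsDeferred w l := by
            intro a ha
            have := h (false :: a) (by simp [leafAddresses, ha])
            simpa [vine, leafAddresses] using this
          have hr : r = nil := by
            refine hnil' r fun a ha => ?_
            have := h (true :: a) (by simp [leafAddresses, ha])
            simpa [vine, leafAddresses] using this
          obtain ⟨A, rfl⟩ := ih hl
          exact ⟨A, by rw [hr]; rfl⟩
        · have hr : IsDeferred w r := by
            intro a ha
            have := h (true :: a) (by simp [leafAddresses, ha])
            simpa [vine, leafAddresses] using this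
          have hl : l = nil := by
            refine hnil' l fun a ha => ?_
            have := h (false :: a) (by simp [leafAddresses, ha])
            simpa [vine, leafAddresses] using this
          obtain ⟨A, rfl⟩ := ih hr
          exact ⟨A, by rw [hl]; rfl⟩
  · rintro ⟨A, rfl⟩
    induction w with
    | nil => intro a _; exact Or.inl (List.nil_prefix)
    | cons b w ih =>
      intro a ha
      cases b <;> simp only [graft, leafAddresses, List.map_cons, List.map_nil, List.mem_append,
        List.mem_map, List.mem_singleton] at ha
      · rcases ha with ⟨v, hv, rfl⟩ | rfl
        · simpa [vine, leafAddresses] using ih v hv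
        · simp [vine, leafAddresses]
      · rcases ha with rfl | ⟨v, hv, rfl⟩
        · simp [vine, leafAddresses]
        · simpa [vine, leafAddresses] using ih v hv

theorem numLeaves_graft (w : List Bool) (A : BTree) :
    (graft w A).numLeaves = A.numLeaves + w.length := by
  induction w with
  | nil => rfl
  | cons b w ih => cases b <;> simp [graft, ih] <;> omega

theorem addCaret_graft (w : List Bool) (A : BTree) {k : ℕ} (hk : k < A.numLeaves) :
    (graft w A).addCaret (w.count true + k) = graft w (A.addCaret k) := by
  induction w with
  | nil => simp [graft]
  | cons b w ih =>
    have := w.count_le_length (a := true)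
    cases b
    · have : w.count true + k < (graft w A).numLeaves := by rw [numLeaves_graft]; omega
      simp [graft, addCaret, this, ih]
    · simp [graft, addCaret, ← ih, show w.count true + 1 + k - 1 = w.count true + k by omega]

end BTree

/-! ### Pure strand diagrams and the pure braided Thompson group -/

/-- A triple `(T₋, p, T₊)` of two trees with the same number of leaves, `n`, and a pure braid
on `n` strands. -/
structure Diagram where
  n : ℕ
  top : BTree
  braid : PureBraid n
  bot : BTree
  top_leaves : top.numLeaves = n
  bot_leaves : bot.numLeaves = n

namespace Diagram

/-- The expansion of a triple at the leaf in position `k` of the bottom tree. As the braid is pure,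
the strand ending there begins at the leaf of the top tree in the same position. -/
def expand (t : Diagram) (k : Fin t.n) : Diagram where
  n := t.n + 1
  top := t.top.addCaret k
  braid := bifurcatePure k t.braid
  bot := t.bot.addCaret k
  top_leaves := by rw [BTree.numLeaves_addCaret, t.top_leaves]
  bot_leaves := by rw [BTree.numLeaves_addCaret, t.bot_leaves]

/-- `t'` is an expansion of `t`, that is, `t` is a reduction of `t'`. -/
def IsExpansion (t t' : Diagram) : Prop := ∃ k, t' = t.expand k

/-- Two triples are equivalent if they can be obtained from each other by a finite sequence of
expansions and reductions. -/
instance setoid : Setoid Diagram := Relation.EqvGen.setoid IsExpansion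

/-- `t'` is obtained from `t` by a finite sequence of expansions. -/
def Expands : Diagram → Diagram → Prop := Relation.ReflTransGen IsExpansion

theorem Expands.equiv {t t' : Diagram} (h : Expands t t') : t ≈ t' := by
  induction h with
  | refl => exact Setoid.refl _
  | tail _ h ih => exact Setoid.trans ih (Relation.EqvGen.rel _ _ h)

theorem expand_comm (t : Diagram) {j k : Fin t.n} (h : j < k) :
    (t.expand j).expand k.succ = (t.expand k).expand j.castSucc := by
  simp only [expand, Fin.val_succ, Fin.val_castSucc]
  congr 1
  · exact BTree.addCaret_comm _ h (by rw [t.top_leaves]; exact k.2)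
  · exact bifurcatePure_comm _ h
  · exact BTree.addCaret_comm _ h (by rw [t.bot_leaves]; exact k.2)

theorem Expands.refines {t t' : Diagram} (h : Expands t t') : t.bot.Refines t'.bot := by
  induction h using Relation.ReflTransGen.head_induction_on with
  | refl => exact BTree.Refines.refl _
  | head h _ ih =>
    obtain ⟨k, rfl⟩ := h
    exact BTree.Refines.of_addCaret ih

/-- A triple can be expanded to any refinement of its bottom tree. -/
theorem exists_expands (t : Diagram) {S : BTree} (h : t.bot.Refines S) :
    ∃ t', Expands t t' ∧ t'.bot = S := by
  obtain ⟨d, hd⟩ : ∃ d, S.numLeaves = t.n + d :=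
    ⟨S.numLeaves - t.n, by have := h.numLeaves_le; rw [t.bot_leaves] at this; omega⟩
  induction d generalizing t with
  | zero =>
    rcases h.eq_or_exists with h | ⟨k, hk, h⟩
    · exact ⟨t, Relation.ReflTransGen.refl, h⟩
    · have := h.numLeaves_le
      rw [BTree.numLeaves_addCaret, t.bot_leaves] at this
      omega
  | succ d ih =>
    rcases h.eq_or_exists with h | ⟨k, hk, h⟩
    · exact ⟨t, Relation.ReflTransGen.refl, h⟩
    · rw [t.bot_leaves] at hk
      obtain ⟨t', h1, h2⟩ := ih (t.expand ⟨k, hk⟩) h (by rw [hd]; simp only [expand]; omega)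
      exact ⟨t', h1.head ⟨_, rfl⟩, h2⟩

/-- An iterated expansion is determined by its bottom tree. -/
theorem Expands.unique {t t₁ t₂ : Diagram} (h₁ : Expands t t₁) (h₂ : Expands t t₂)
    (h : t₁.bot = t₂.bot) : t₁ = t₂ := by
  obtain ⟨d, hd⟩ : ∃ d, t₁.n = t.n + d :=
    ⟨t₁.n - t.n, by
      have := h₁.refines.numLeaves_le; rw [t.bot_leaves, t₁.bot_leaves] at this; omega⟩
  induction d generalizing t t₁ t₂ with
  | zero =>
    have key : ∀ t', t'.n = t.n → Expands t t' → t = t' := by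
      intro t' hn h'
      rcases Relation.ReflTransGen.cases_head h' with h' | ⟨u, ⟨k, rfl⟩, hu⟩
      · exact h'
      · have := (Expands.refines hu).numLeaves_le
        rw [(t.expand k).bot_leaves, t'.bot_leaves] at this
        simp only [expand] at this
        omega
    have hn : t₂.n = t₁.n := by rw [← t₁.bot_leaves, ← t₂.bot_leaves, h]
    rw [← key t₁ hd h₁, ← key t₂ (hn.trans hd) h₂]
  | succ d ih =>
    have hn : t₂.n = t₁.n := by rw [← t₁.bot_leaves, ← t₂.bot_leaves, h]
    rcases Relation.ReflTransGen.cases_head h₁ with rfl | ⟨u₁, ⟨j, rfl⟩, hu₁⟩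
    · omega
    rcases Relation.ReflTransGen.cases_head h₂ with rfl | ⟨u₂, ⟨k, rfl⟩, hu₂⟩
    · omega
    have hd₁ : ∀ i, t₁.n = (t.expand i).n + d := fun i => by simp only [expand]; omega
    have hd₂ : ∀ i, t₂.n = (t.expand i).n + d := fun i => by rw [hn]; exact hd₁ i
    suffices H : ∀ {t₁ t₂ : Diagram} {j k : Fin t.n}, j < k → Expands (t.expand j) t₁ →
        Expands (t.expand k) t₂ → t₁.bot = t₂.bot → t₁.n = t.n + (d + 1) → t₁ = t₂ by
      rcases lt_trichotomy j k with hjk | rfl | hjk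
      · exact H hjk hu₁ hu₂ h hd
      · exact ih hu₁ hu₂ h (hd₁ j)
      · exact (H hjk hu₂ hu₁ h.symm (hn.trans hd)).symm
    clear * - ih
    intro t₁ t₂ j k hjk hu₁ hu₂ h hd
    have hn : t₂.n = t₁.n := by rw [← t₁.bot_leaves, ← t₂.bot_leaves, h]
    have hr₁ := Expands.refines hu₁
    have hr₂ := Expands.refines hu₂
    rw [← h] at hr₂
    obtain ⟨t₃, hu₃, h₃⟩ := exists_expands ((t.expand j).expand k.succ) (S := t₁.bot)
      (BTree.Refines.addCaret_addCaret hjk (by rw [t.bot_leaves]; exact k.2) hr₁ hr₂)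
    have e₁ : t₁ = t₃ := ih (t := t.expand j) hu₁ (hu₃.head ⟨_, rfl⟩) h₃.symm
      (by simp only [expand]; omega)
    rw [expand_comm t hjk] at hu₃
    have e₂ : t₂ = t₃ := ih (t := t.expand k) hu₂ (hu₃.head ⟨_, rfl⟩) (by rw [h₃, h])
      (by simp only [expand]; omega)
    rw [e₁, e₂]

theorem equiv_iff {t t' : Diagram} : t ≈ t' ↔ ∃ u, Expands t u ∧ Expands t' u := by
  constructor
  · intro h
    induction h with
    | rel a b h => exact ⟨b, Relation.ReflTransGen.single h, Relation.ReflTransGen.refl⟩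
    | refl a => exact ⟨a, Relation.ReflTransGen.refl, Relation.ReflTransGen.refl⟩
    | symm a b _ ih => obtain ⟨u, h1, h2⟩ := ih; exact ⟨u, h2, h1⟩
    | trans a b c _ _ ih1 ih2 =>
      obtain ⟨u, h1, h2⟩ := ih1
      obtain ⟨v, h3, h4⟩ := ih2
      obtain ⟨S, hS1, hS2⟩ := BTree.exists_refines u.bot v.bot
      obtain ⟨u', hu, rfl⟩ := exists_expands u hS1
      obtain ⟨v', hv, hv'⟩ := exists_expands v hS2
      have : v' = u' := Expands.unique (h3.trans hv) (h2.trans hu) hv'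
      subst this
      exact ⟨v', h1.trans hu, h4.trans hv⟩
  · rintro ⟨u, h1, h2⟩
    exact Setoid.trans h1.equiv (Setoid.symm h2.equiv)

/-- The inverse triple `(T₊, p⁻¹, T₋)`. -/
def inv (t : Diagram) : Diagram where
  n := t.n
  top := t.bot
  braid := t.braid⁻¹
  bot := t.top
  top_leaves := t.bot_leaves
  bot_leaves := t.top_leaves

theorem inv_inv (t : Diagram) : t.inv.inv = t := by
  simp only [inv]
  congr 1
  exact _root_.inv_inv t.braid

theorem inv_expand (t : Diagram) (k : Fin t.n) : (t.expand k).inv = t.inv.expand k := by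
  simp only [inv, expand]
  congr 1
  exact (map_inv (bifurcatePure k) t.braid).symm

theorem Expands.inv {t t' : Diagram} (h : Expands t t') : Expands t.inv t'.inv := by
  induction h with
  | refl => exact Relation.ReflTransGen.refl
  | tail _ h ih =>
    obtain ⟨k, rfl⟩ := h
    rw [inv_expand]
    exact ih.tail ⟨_, rfl⟩

theorem inv_equiv {t t' : Diagram} (h : t ≈ t') : t.inv ≈ t'.inv := by
  obtain ⟨u, h1, h2⟩ := equiv_iff.1 h
  exact equiv_iff.2 ⟨_, h1.inv, h2.inv⟩

theorem exists_expands_top (t : Diagram) {S : BTree} (h : t.top.Refines S) :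
    ∃ t', Expands t t' ∧ t'.top = S := by
  obtain ⟨t', h1, h2⟩ := exists_expands t.inv (S := S) h
  exact ⟨t'.inv, by simpa [inv_inv] using h1.inv, h2⟩

theorem Expands.unique_top {t t₁ t₂ : Diagram} (h₁ : Expands t t₁) (h₂ : Expands t t₂)
    (h : t₁.top = t₂.top) : t₁ = t₂ := by
  rw [← inv_inv t₁, ← inv_inv t₂, Expands.unique h₁.inv h₂.inv h]

/-- `c` is the composite of `a = (T, p, U)` and `b = (U, q, W)`, that is, `c = (T, p * q, W)`. -/
inductive Comp : Diagram → Diagram → Diagram → Prop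
  | mk {n : ℕ} (T : BTree) (p : PureBraid n) (U : BTree) (q : PureBraid n) (W : BTree)
      (hT : T.numLeaves = n) (hU : U.numLeaves = n) (hW : W.numLeaves = n) :
      Comp ⟨n, T, p, U, hT, hU⟩ ⟨n, U, q, W, hU, hW⟩ ⟨n, T, p * q, W, hT, hW⟩

theorem Comp.bot_eq_top {a b c : Diagram} (h : Comp a b c) : a.bot = b.top := by
  cases h; rfl

theorem Comp.unique {a b c c' : Diagram} (h : Comp a b c) (h' : Comp a b c') : c = c' := by
  cases h; cases h'; rfl

theorem exists_comp {a b : Diagram} (h : a.bot = b.top) : ∃ c, Comp a b c := by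
  obtain ⟨n, T, p, U, hT, hU⟩ := a
  obtain ⟨m, U', q, W, hU', hW⟩ := b
  obtain rfl : U = U' := h
  obtain rfl : n = m := hU.symm.trans hU'
  exact ⟨_, Comp.mk T p U q W hT hU hW⟩

theorem Comp.expands_left {a b c a' : Diagram} (h : Comp a b c) (ha : Expands a a') :
    ∃ b' c', Expands b b' ∧ Expands c c' ∧ Comp a' b' c' := by
  induction ha with
  | refl => exact ⟨b, c, Relation.ReflTransGen.refl, Relation.ReflTransGen.refl, h⟩
  | tail _ h ih =>
    obtain ⟨b', c', hb, hc, h'⟩ := ih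
    obtain ⟨k, rfl⟩ := h
    obtain ⟨T, p, U, q, W, hT, hU, hW⟩ := h'
    refine ⟨_, _, hb.tail ⟨k, rfl⟩, hc.tail ⟨k, rfl⟩, ?_⟩
    simp only [expand, map_mul]
    exact Comp.mk _ _ _ _ _ _ _ _

theorem Comp.expands {a b c a' b' : Diagram} (h : Comp a b c) (ha : Expands a a')
    (hb : Expands b b') (h' : a'.bot = b'.top) : ∃ c', Expands c c' ∧ Comp a' b' c' := by
  obtain ⟨b'', c', hb'', hc, H⟩ := h.expands_left ha
  have := Expands.unique_top hb hb'' (h'.symm.trans H.bot_eq_top)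
  subst this
  exact ⟨c', hc, H⟩

theorem Comp.equiv {a b c a' b' c' : Diagram} (h : Comp a b c) (h' : Comp a' b' c')
    (ha : a ≈ a') (hb : b ≈ b') : c ≈ c' := by
  obtain ⟨u, hu, hu'⟩ := equiv_iff.1 ha
  obtain ⟨v, hv, hv'⟩ := equiv_iff.1 hb
  obtain ⟨S, hS1, hS2⟩ := BTree.exists_refines u.bot v.top
  obtain ⟨u₁, hu₁, rfl⟩ := exists_expands u hS1
  obtain ⟨v₁, hv₁, e⟩ := exists_expands_top v hS2
  obtain ⟨w, hw, H⟩ := h.expands (hu.trans hu₁) (hv.trans hv₁) e.symm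
  obtain ⟨w', hw', H'⟩ := h'.expands (hu'.trans hu₁) (hv'.trans hv₁) e.symm
  exact equiv_iff.2 ⟨w, hw, H'.unique H ▸ hw'⟩

theorem exists_expands_comp (a b : Diagram) :
    ∃ a' b' c, Expands a a' ∧ Expands b b' ∧ Comp a' b' c := by
  obtain ⟨S, hS1, hS2⟩ := BTree.exists_refines a.bot b.top
  obtain ⟨a', ha, rfl⟩ := exists_expands a hS1
  obtain ⟨b', hb, e⟩ := exists_expands_top b hS2
  obtain ⟨c, hc⟩ := exists_comp e.symm
  exact ⟨a', b', c, ha, hb, hc⟩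

/-- The product of two triples: expand them until the bottom tree of the first one is the top tree
of the second one, and compose. -/
noncomputable def comp (a b : Diagram) : Diagram :=
  (exists_expands_comp a b).choose_spec.choose_spec.choose

theorem comp_equiv {a b a' b' c : Diagram} (ha : a ≈ a') (hb : b ≈ b') (h : Comp a' b' c) :
    comp a b ≈ c := by
  have H := (exists_expands_comp a b).choose_spec.choose_spec.choose_spec
  exact Comp.equiv H.2.2 h (Setoid.trans (Setoid.symm H.1.equiv) ha)
    (Setoid.trans (Setoid.symm H.2.1.equiv) hb)

end Diagram

/-- The pure braided Thompson group: equivalence classes of triples `(T₋, p, T₊)`, where `T₋` and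
`T₊` are finite rooted binary trees with the same number of leaves and `p` is a pure braid. -/
def Fbr : Type := Quotient Diagram.setoid

namespace Fbr

open Diagram

/-- The class `[T₋, p, T₊]` of a triple. -/
def mk (t : Diagram) : Fbr := Quotient.mk Diagram.setoid t

theorem mk_eq {t t' : Diagram} : mk t = mk t' ↔ t ≈ t' := Quotient.eq

theorem mk_expands {t t' : Diagram} (h : Expands t t') : mk t = mk t' := mk_eq.2 h.equiv

noncomputable instance : Mul Fbr :=
  ⟨Quotient.map₂ comp fun a a' ha b b' hb => by
    obtain ⟨u, v, c, hu, hv, h⟩ := exists_expands_comp a' b'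
    exact Setoid.trans (comp_equiv (Setoid.trans ha hu.equiv) (Setoid.trans hb hv.equiv) h)
      (Setoid.symm (comp_equiv hu.equiv hv.equiv h))⟩

instance : Inv Fbr := ⟨Quotient.map Diagram.inv fun _ _ h => inv_equiv h⟩

instance : One Fbr := ⟨mk ⟨1, .nil, 1, .nil, rfl, rfl⟩⟩

theorem mk_mul_mk {a b c : Diagram} (h : Comp a b c) : mk a * mk b = mk c :=
  mk_eq.2 (comp_equiv (Setoid.refl a) (Setoid.refl b) h)

theorem inv_mk (t : Diagram) : (mk t)⁻¹ = mk t.inv := rfl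

/-- The class of `(T, 1, T)` is the identity. -/
theorem mk_one {n : ℕ} (T : BTree) (hT : T.numLeaves = n) : mk ⟨n, T, 1, T, hT, hT⟩ = 1 := by
  obtain ⟨t', h, h'⟩ := exists_expands ⟨1, .nil, 1, .nil, rfl, rfl⟩ (S := T) trivial
  have key : t'.braid = 1 ∧ t'.top = t'.bot := by
    clear h'
    induction h with
    | refl => exact ⟨rfl, rfl⟩
    | tail _ h ih =>
      obtain ⟨k, rfl⟩ := h
      exact ⟨by simp only [expand, ih.1, map_one]; rfl, by simp only [expand, ih.2]⟩
  refine Eq.trans ?_ (mk_expands h).symm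
  obtain ⟨m, U, p, U', hU, hU'⟩ := t'
  simp only at h' key
  obtain ⟨hp, rfl⟩ := key
  subst h'
  obtain rfl : n = m := hT.symm.trans hU
  rw [← hp]

noncomputable instance : Group Fbr :=
  Group.ofLeftAxioms
    (by
      intro x y z
      induction x using Quotient.ind with | _ a => ?_
      induction y using Quotient.ind with | _ b => ?_
      induction z using Quotient.ind with | _ c => ?_
      change mk a * mk b * mk c = mk a * (mk b * mk c)
      obtain ⟨b', c', d, hb, hc, h⟩ := exists_expands_comp b c
      obtain ⟨a', b'', e, ha, hb', h'⟩ := exists_expands_comp a b'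
      obtain ⟨c'', d', hc', hd, h''⟩ := h.expands_left hb'
      rw [mk_expands ha, mk_expands (hb.trans hb'), mk_expands (hc.trans hc'), mk_mul_mk h',
        mk_mul_mk h'']
      obtain ⟨T, p, U, q, W, hT, hU, hW⟩ := h'
      generalize hβ : (⟨_, U, q, W, hU, hW⟩ : Diagram) = β at h''
      obtain ⟨T', p', U', q', W', hT', hU', hW'⟩ := h''
      cases hβ
      rw [mk_mul_mk (Comp.mk T p U (q * q') W' hT hU hW'),
        mk_mul_mk (Comp.mk T (p * q) W q' W' hT hW hW'), mul_assoc])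
    (by
      intro x
      induction x using Quotient.ind with | _ a => ?_
      obtain ⟨n, T, p, U, hT, hU⟩ := a
      change (1 : Fbr) * mk _ = mk _
      rw [← mk_one T hT, mk_mul_mk (Comp.mk T 1 T p U hT hT hU), one_mul])
    (by
      intro x
      induction x using Quotient.ind with | _ a => ?_
      obtain ⟨n, T, p, U, hT, hU⟩ := a
      change mk (Diagram.inv ⟨n, T, p, U, hT, hU⟩) * mk _ = 1
      rw [Diagram.inv, mk_mul_mk (Comp.mk U p⁻¹ T p U hU hT hU), inv_mul_cancel, mk_one])

end Fbr

/-- The iterated expansions of a triple of the form `(graft w A, p, graft w B)` that only add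
carets below the vertices with address `w`. -/
theorem exists_expands_graft (w : List Bool) {t : Diagram} {A B B' : BTree}
    (hA : t.top = BTree.graft w A) (hB : t.bot = BTree.graft w B) (h : B.Refines B') :
    ∃ t' A', Diagram.Expands t t' ∧ t'.top = BTree.graft w A' ∧ t'.bot = BTree.graft w B' := by
  have hAB : ∀ {t : Diagram} {A B : BTree}, t.top = BTree.graft w A → t.bot = BTree.graft w B →
      A.numLeaves = B.numLeaves ∧ t.n = B.numLeaves + w.length := by
    intro t A B hA hB
    have h1 := t.top_leaves
    have h2 := t.bot_leaves
    rw [hA, BTree.numLeaves_graft] at h1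
    rw [hB, BTree.numLeaves_graft] at h2
    omega
  have hcount := w.count_le_length (a := true)
  obtain ⟨d, hd⟩ : ∃ d, B'.numLeaves = B.numLeaves + d :=
    ⟨B'.numLeaves - B.numLeaves, by have := h.numLeaves_le; omega⟩
  induction d generalizing t A B with
  | zero =>
    rcases h.eq_or_exists with rfl | ⟨k, hk, h⟩
    · exact ⟨t, A, Relation.ReflTransGen.refl, hA, hB⟩
    · have := h.numLeaves_le
      rw [BTree.numLeaves_addCaret] at this
      omega
  | succ d ih =>
    rcases h.eq_or_exists with rfl | ⟨k, hk, h⟩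
    · exact ⟨t, A, Relation.ReflTransGen.refl, hA, hB⟩
    · obtain ⟨h1, h2⟩ := hAB hA hB
      obtain ⟨t', A', ht, h'⟩ := ih (t := t.expand ⟨w.count true + k, by omega⟩)
        (A := A.addCaret k) (B := B.addCaret k)
        (by rw [← BTree.addCaret_graft w A (by omega), ← hA]; rfl)
        (by rw [← BTree.addCaret_graft w B hk, ← hB]; rfl) h
        (by rw [BTree.numLeaves_addCaret]; omega)
      exact ⟨t', A', ht.head ⟨_, rfl⟩, h'⟩

open Diagram in
/-- The subgroup `Fbr(w)` of the classes `[T₋, p, T₊]` such that `T₋` and `T₊` are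
`w`-deferred. -/
def FbrDeferred (w : List Bool) : Subgroup Fbr where
  carrier := {x | ∃ t : Diagram, t.top.IsDeferred w ∧ t.bot.IsDeferred w ∧ x = Fbr.mk t}
  one_mem' := ⟨⟨(BTree.vine w).numLeaves, BTree.vine w, 1, BTree.vine w, rfl, rfl⟩,
    fun _ h => Or.inr h, fun _ h => Or.inr h, (Fbr.mk_one _ rfl).symm⟩
  inv_mem' := by
    rintro _ ⟨t, h1, h2, rfl⟩
    exact ⟨t.inv, h2, h1, rfl⟩
  mul_mem' := by
    rintro _ _ ⟨a, h1, h2, rfl⟩ ⟨b, h3, h4, rfl⟩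
    obtain ⟨A, hA⟩ := BTree.isDeferred_iff.1 h1
    obtain ⟨B, hB⟩ := BTree.isDeferred_iff.1 h2
    obtain ⟨C, hC⟩ := BTree.isDeferred_iff.1 h3
    obtain ⟨D, hD⟩ := BTree.isDeferred_iff.1 h4
    obtain ⟨R, hR1, hR2⟩ := BTree.exists_refines B C
    obtain ⟨a', A', ha, hA', hB'⟩ := exists_expands_graft w hA hB hR1
    obtain ⟨b', D', hb, hD', hC'⟩ := exists_expands_graft w (t := b.inv) hD hC hR2
    replace hb := hb.inv
    rw [inv_inv] at hb
    obtain ⟨c, hc⟩ := exists_comp (a := a') (b := b'.inv) (hB'.trans hC'.symm)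
    refine ⟨c, BTree.isDeferred_iff.2 ⟨A', ?_⟩, BTree.isDeferred_iff.2 ⟨D', ?_⟩, ?_⟩
    · rw [← hA']; cases hc; rfl
    · change b'.inv.bot = _ at hD'
      rw [← hD']
      generalize b'.inv = v at hc
      cases hc; rfl
    · rw [Fbr.mk_expands ha, Fbr.mk_expands hb, Fbr.mk_mul_mk hc]

end BraidedThompson

/-!
The two groups are told apart by their abelianizations: that of the pure braided Thompson group is
generated by four elements, whereas the `w`-deferred subgroup has five independent homomorphisms to
the integers if `w` has length at least three.

For the upper bound, let `f` be a homomorphism from the pure braided Thompson group to an abelian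
group. The values `f [T, p, T]` do not depend on the tree `T`, since different trees give conjugate
elements, and so `f` induces homomorphisms on all pure braid groups, compatible with bifurcation.
A pure braid group is generated by the conjugates `b * s 0 ^ 2 * b⁻¹`
(`pureBraid_eq_sqSubgroup`), and the value on such a conjugate depends only on the two strands that
wind around each other (`map_conjSq_eq`). Bifurcating a third strand shows that the value depends
only on whether there are strands to the left of, between, and to the right of these two;
bifurcating one of the two gives linear relations between the eight remaining values, all of which
are determined by two of them (`eq_one_of_linkValue_eq_one`). The elements `[T, 1, U]` contribute
two more generators, as in Thompson's group `F` (`Fbr.map_treePair_eq_one`).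

For the lower bound, each pair of points of the Cantor set has a linking number in every triple,
that of the strands ending at the leaves above them, and this number does not change under
expansion (`cross_bifurcate`). The `w`-deferred subgroup fixes the points below the leaves of the
vine to `w` other than `w` itself, and the leftmost and rightmost points below `w`. One point below
each of those leaves and these two give `w.length + 2` points, whose linking numbers are
homomorphisms on the subgroup (`link_mul`). With five points there are
five pairs for which they are independent (`eq_zero_of_sum_cross_eq_zero`).
-/

namespace BraidedThompson

/-! ### Generators of the pure braid group -/

/-- The normal closure of the square of the first standard generator of the braid group. -/
def sqSubgroup (n : ℕ) : Subgroup (Braid n) := Subgroup.normalClosure {s n 0 * s n 0}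

instance (n : ℕ) : (sqSubgroup n).Normal := Subgroup.normalClosure_normal

theorem s_of_le {n i : ℕ} (h : n ≤ i + 1) : s n i = 1 := dif_neg (by omega)

/-- Adjacent standard generators are conjugate. -/
theorem s_succ_eq_conj {n i : ℕ} (h : i + 2 < n) :
    s n (i + 1) = (s n i * s n (i + 1)) * s n i * (s n i * s n (i + 1))⁻¹ := by
  rw [s_braid h]
  group

theorem s_mul_s_mem_sqSubgroup (n i : ℕ) : s n i * s n i ∈ sqSubgroup n := by
  induction i with
  | zero => exact Subgroup.subset_normalClosure rfl
  | succ i ih =>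
    by_cases h : i + 2 < n
    · have := (inferInstance : (sqSubgroup n).Normal).conj_mem _ ih (s n i * s n (i + 1))
      convert this using 1
      conv_lhs => rw [s_succ_eq_conj h]
      group
    · rw [s_of_le (by omega), one_mul]
      exact one_mem _

theorem sqSubgroup_le_pureBraid (n : ℕ) : sqSubgroup n ≤ PureBraid n := by
  refine Subgroup.normalClosure_le_normal ?_
  rintro _ rfl
  by_cases h : 1 < n
  · simp [MonoidHom.mem_ker, strandPerm_s (n := n) (i := 0) (by omega), adjSwap]
  · simp [s_of_le (n := n) (i := 0) (by omega)]

/-- The braid `s (j + d - 1) ⋯ s (j + 1) s j`, which moves the strand in position `j` to the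
position `j + d`. -/
def shiftBraid (n j : ℕ) : ℕ → Braid n
  | 0 => 1
  | d + 1 => s n (j + d) * shiftBraid n j d

theorem strandPerm_shiftBraid {n j d : ℕ} (h : j + d < n) :
    strandPerm n (shiftBraid n j d) ⟨j, by omega⟩ = ⟨j + d, h⟩ := by
  induction d with
  | zero => simp [shiftBraid]
  | succ d ih =>
    rw [shiftBraid, map_mul, Equiv.Perm.mul_apply, ih (by omega)]
    ext
    rw [strandPerm_s_val (by omega)]
    simp [posSwap, add_assoc]

theorem strandPerm_shiftBraid_lt {n j d i : ℕ} (h : j + d < n) (hi : i < j) :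
    strandPerm n (shiftBraid n j d) ⟨i, by omega⟩ = ⟨i, by omega⟩ := by
  induction d with
  | zero => simp [shiftBraid]
  | succ d ih =>
    rw [shiftBraid, map_mul, Equiv.Perm.mul_apply, ih (by omega)]
    ext
    rw [strandPerm_s_val (by omega)]
    simp only [posSwap]
    split_ifs <;> omega

theorem s_mul_shiftBraid_of_lt {n j d i : ℕ} (h : j + d < i) :
    s n i * shiftBraid n j d = shiftBraid n j d * s n i := by
  induction d with
  | zero => simp [shiftBraid]
  | succ d ih =>
    rw [shiftBraid, ← mul_assoc, ← s_comm n (by omega), mul_assoc, ih (by omega), mul_assoc]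

theorem s_mul_shiftBraid_of_gt {n j d i : ℕ} (hj : j ≤ i) (hi : i + 1 < j + d) (h : j + d < n) :
    s n i * shiftBraid n j d = shiftBraid n j d * s n (i + 1) := by
  induction d with
  | zero => omega
  | succ d ih =>
    rcases (show i + 1 < j + d ∨ i + 1 = j + d by omega) with h' | h'
    · rw [shiftBraid, ← mul_assoc, s_comm n h', mul_assoc, ih h' (by omega), mul_assoc]
    · obtain ⟨e, rfl⟩ : ∃ e, d = e + 1 := ⟨d - 1, by omega⟩
      obtain rfl : i = j + e := by omega
      simp only [shiftBraid, ← add_assoc]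
      rw [← mul_assoc, ← mul_assoc, s_braid (by omega)]
      simp only [mul_assoc]
      rw [s_mul_shiftBraid_of_lt (by omega)]

/-- The subgroup generated by `sqSubgroup n` and the standard generators of index at least `j`. -/
def tailSubgroup (n j : ℕ) : Subgroup (Braid n) :=
  Subgroup.closure ({x | ∃ i, j ≤ i ∧ x = s n i} ∪ sqSubgroup n)

theorem s_mem_tailSubgroup {n j i : ℕ} (h : j ≤ i) : s n i ∈ tailSubgroup n j :=
  Subgroup.subset_closure (Or.inl ⟨i, h, rfl⟩)

theorem sqSubgroup_le_tailSubgroup (n j : ℕ) : sqSubgroup n ≤ tailSubgroup n j :=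
  fun _ hx => Subgroup.subset_closure (Or.inr hx)

/-- The braids `shiftBraid n j d` represent the left cosets of `tailSubgroup n (j + 1)` in
`tailSubgroup n j`. -/
theorem exists_eq_shiftBraid_mul {n j : ℕ} (hj : j < n) {x : Braid n}
    (hx : x ∈ tailSubgroup n j) :
    ∃ d, j + d < n ∧ ∃ y ∈ tailSubgroup n (j + 1), x = shiftBraid n j d * y := by
  have hN : ∀ u ∈ sqSubgroup n, ∀ x,
      (∃ d, j + d < n ∧ ∃ y ∈ tailSubgroup n (j + 1), x = shiftBraid n j d * y) →
      ∃ d, j + d < n ∧ ∃ y ∈ tailSubgroup n (j + 1), u * x = shiftBraid n j d * y := by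
    rintro u hu _ ⟨d, hd, y, hy, rfl⟩
    refine ⟨d, hd, ((shiftBraid n j d)⁻¹ * u * (shiftBraid n j d)⁻¹⁻¹) * y, mul_mem
      (sqSubgroup_le_tailSubgroup _ _
        ((inferInstance : (sqSubgroup n).Normal).conj_mem _ hu _)) hy, ?_⟩
    group
  -- A generator carries a coset to a coset, up to the square of a generator.
  have hS : ∀ i, j ≤ i → ∀ x,
      (∃ d, j + d < n ∧ ∃ y ∈ tailSubgroup n (j + 1), x = shiftBraid n j d * y) →
      ∃ d, j + d < n ∧ ∃ y ∈ tailSubgroup n (j + 1), s n i * x = shiftBraid n j d * y := by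
    rintro i hi _ ⟨d, hd, y, hy, rfl⟩
    by_cases hin : n ≤ i + 1
    · exact ⟨d, hd, y, hy, by rw [s_of_le hin, one_mul]⟩
    obtain h | h | h | h : j + d < i ∨ i = j + d ∨ i + 1 = j + d ∨ i + 1 < j + d := by omega
    · exact ⟨d, hd, s n i * y, mul_mem (s_mem_tailSubgroup (by omega)) hy, by
        rw [← mul_assoc, s_mul_shiftBraid_of_lt h, mul_assoc]⟩
    · exact ⟨d + 1, by omega, y, hy, by rw [shiftBraid, h, mul_assoc]⟩
    · obtain ⟨e, rfl⟩ : ∃ e, d = e + 1 := ⟨d - 1, by omega⟩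
      obtain rfl : i = j + e := by omega
      have := hN _ (s_mul_s_mem_sqSubgroup n (j + e)) _ ⟨e, by omega, y, hy, rfl⟩
      simpa only [shiftBraid, mul_assoc] using this
    · exact ⟨d, hd, s n (i + 1) * y, mul_mem (s_mem_tailSubgroup (by omega)) hy, by
        rw [← mul_assoc, s_mul_shiftBraid_of_gt hi h hd, mul_assoc]⟩
  induction hx using Subgroup.closure_induction_left with
  | one => exact ⟨0, hj, 1, one_mem _, by simp [shiftBraid]⟩
  | mul_left x hx y _ ih =>
    rcases hx with ⟨i, hi, rfl⟩ | hx
    · exact hS i hi _ ih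
    · exact hN x hx _ ih
  | inv_mul_cancel x hx y _ ih =>
    rcases hx with ⟨i, hi, rfl⟩ | hx
    · have := hN _ (inv_mem (s_mul_s_mem_sqSubgroup n i)) _ (hS i hi _ ih)
      convert this using 6
      group
    · exact hN _ (inv_mem hx) _ ih

theorem strandPerm_of_mem_tailSubgroup {n j : ℕ} {x : Braid n} (hx : x ∈ tailSubgroup n j)
    {i : Fin n} (hi : i.1 < j) : strandPerm n x i = i := by
  induction hx using Subgroup.closure_induction with
  | mem x hx =>
    rcases hx with ⟨l, hl, rfl⟩ | hx
    · by_cases h : l + 1 < n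
      · ext
        rw [strandPerm_s_val h]
        simp only [posSwap]
        split_ifs <;> omega
      · simp [s_of_le (n := n) (i := l) (by omega)]
    · rw [MonoidHom.mem_ker.1 (sqSubgroup_le_pureBraid n hx)]; rfl
  | one => simp
  | mul x y _ _ hx hy => rw [map_mul, Equiv.Perm.mul_apply, hy, hx]
  | inv x _ hx => rw [map_inv, Equiv.Perm.inv_eq_iff_eq, hx]

theorem mem_tailSubgroup_succ {n j : ℕ} (hj : j < n) {x : Braid n} (hx : x ∈ tailSubgroup n j)
    (h : strandPerm n x ⟨j, hj⟩ = ⟨j, hj⟩) : x ∈ tailSubgroup n (j + 1) := by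
  obtain ⟨d, hd, y, hy, rfl⟩ := exists_eq_shiftBraid_mul hj hx
  rw [map_mul, Equiv.Perm.mul_apply, strandPerm_of_mem_tailSubgroup hy (by simp),
    strandPerm_shiftBraid hd, Fin.mk.injEq] at h
  obtain rfl : d = 0 := by omega
  simpa [shiftBraid] using hy

theorem mem_tailSubgroup_zero {n : ℕ} (x : Braid n) : x ∈ tailSubgroup n 0 := by
  induction x using braid_induction with
  | hs i _ => exact s_mem_tailSubgroup (Nat.zero_le i)
  | h1 => exact one_mem _
  | hm a b ha hb => exact mul_mem ha hb
  | hi a ha => exact inv_mem ha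

theorem mem_tailSubgroup_of_strandPerm {n j : ℕ} (hj : j ≤ n) {x : Braid n}
    (h : ∀ i : Fin n, i.1 < j → strandPerm n x i = i) : x ∈ tailSubgroup n j := by
  induction j with
  | zero => exact mem_tailSubgroup_zero x
  | succ j ih =>
    exact mem_tailSubgroup_succ hj (ih (by omega) fun i hi => h i (by omega)) (h _ (by simp))

/-- The pure braid group is the normal closure of the square of a standard generator. -/
theorem pureBraid_eq_sqSubgroup (n : ℕ) : PureBraid n = sqSubgroup n := by
  refine le_antisymm (fun x hx => ?_) (sqSubgroup_le_pureBraid n)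
  have := mem_tailSubgroup_of_strandPerm (le_refl n) (x := x)
    fun i _ => by rw [MonoidHom.mem_ker.1 hx]; rfl
  refine (Subgroup.closure_le _).2 ?_ this
  rintro y (⟨i, hi, rfl⟩ | hy)
  · rw [s_of_le (by omega)]
    exact one_mem _
  · exact hy

/-- A braid fixing the positions `0` and `1` is, up to a pure braid, a braid commuting with the
first standard generator. -/
theorem exists_pure_mul_commute {n : ℕ} (hn : 2 ≤ n) {x : Braid n}
    (h0 : strandPerm n x ⟨0, by omega⟩ = ⟨0, by omega⟩)
    (h1 : strandPerm n x ⟨1, by omega⟩ = ⟨1, by omega⟩) :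
    ∃ p ∈ PureBraid n, ∃ g, Commute g (s n 0) ∧ x = p * g := by
  have hx : x ∈ tailSubgroup n 2 := mem_tailSubgroup_of_strandPerm hn fun i hi => by
    obtain ⟨i, hi'⟩ := i
    obtain rfl | rfl : i = 0 ∨ i = 1 := by simp at hi; omega
    · exact h0
    · exact h1
  have hsup : tailSubgroup n 2 ≤ PureBraid n ⊔ Subgroup.centralizer {s n 0} := by
    refine (Subgroup.closure_le _).2 ?_
    rintro y (⟨i, hi, rfl⟩ | hy)
    · refine Subgroup.mem_sup_right (Subgroup.mem_centralizer_singleton_iff.2 ?_)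
      exact (s_comm n (by omega)).symm
    · exact Subgroup.mem_sup_left (sqSubgroup_le_pureBraid n hy)
  obtain ⟨p, hp, g, hg, rfl⟩ := Subgroup.mem_sup_of_normal_left.1 (hsup hx)
  exact ⟨p, hp, g, Subgroup.mem_centralizer_singleton_iff.1 hg, rfl⟩

/-- Any two distinct positions are the ends of the strands in positions `0` and `1` of a braid. -/
theorem exists_strandPerm_eq {n : ℕ} {i j : Fin n} (h : i ≠ j) (hn : 2 ≤ n) :
    ∃ b, strandPerm n b ⟨0, by omega⟩ = i ∧ strandPerm n b ⟨1, by omega⟩ = j := by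
  have hi : strandPerm n (shiftBraid n 0 i) ⟨0, by omega⟩ = i := by
    rw [strandPerm_shiftBraid (by omega)]; simp
  obtain ⟨k, hk⟩ : ∃ k, k = (strandPerm n (shiftBraid n 0 i))⁻¹ j := ⟨_, rfl⟩
  have hk0 : k ≠ ⟨0, by omega⟩ := fun h' => h (by rw [← hi, ← h', hk]; simp)
  have hk1 : 1 ≤ k.1 := by
    by_contra h'
    exact hk0 (Fin.ext (by simp; omega))
  refine ⟨shiftBraid n 0 i * shiftBraid n 1 (k - 1), ?_, ?_⟩
  · rw [map_mul, Equiv.Perm.mul_apply, strandPerm_shiftBraid_lt (by omega) Nat.one_pos, hi]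
  · rw [map_mul, Equiv.Perm.mul_apply, strandPerm_shiftBraid (by omega)]
    have : (⟨1 + (k.1 - 1), by omega⟩ : Fin n) = k := Fin.ext (by simp; omega)
    rw [this, hk]
    simp

/-! ### Homomorphisms on pure braid groups invariant under bifurcation -/

theorem strandPerm_bifurcate_castSucc {n : ℕ} (b : Braid n) (k : Fin n) :
    strandPerm (n + 1) (bifurcate k b) k.castSucc = (strandPerm n b k).castSucc := by
  by_contra h
  obtain ⟨l, hl⟩ := Fin.exists_succAbove_eq h
  obtain ⟨m, rfl⟩ := (strandPerm n b).surjective l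
  rw [← strandPerm_bifurcate] at hl
  exact Fin.succAbove_ne _ _ ((strandPerm (n + 1) (bifurcate k b)).injective hl)

theorem strandPerm_bifurcate_succ {n : ℕ} (b : Braid n) (k : Fin n) :
    strandPerm (n + 1) (bifurcate k b) k.succ = (strandPerm n b k).succ := by
  have := strandPerm_bifurcate b k k
  rwa [Fin.succAbove_castSucc_self, Fin.succAbove_castSucc_self] at this

/-- The conjugate by `b` of the full twist of the first two strands: the strands in positions
`strandPerm n b 0` and `strandPerm n b 1` wind around each other once. -/
def conjSq {n : ℕ} (b : Braid n) : PureBraid n :=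
  ⟨b * (s n 0 * s n 0) * b⁻¹, (inferInstance : (PureBraid n).Normal).conj_mem _
    (sqSubgroup_le_pureBraid n (s_mul_s_mem_sqSubgroup n 0)) b⟩

theorem conjSq_mul_s {n : ℕ} (b : Braid n) : conjSq (b * s n 0) = conjSq b :=
  Subtype.ext (by simp only [conjSq]; group)

theorem bifurcate_conj {n : ℕ} (b : Braid n) {q : Braid n} (hq : q ∈ PureBraid n) (k : Fin n) :
    bifurcate (strandPerm n b k) (b * q * b⁻¹) =
      bifurcate k b * bifurcate k q * (bifurcate k b)⁻¹ := by
  rw [bifurcate_mul, bifurcate_mul, bifurcate_inv]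
  simp [MonoidHom.mem_ker.1 hq]

theorem bifurcatePure_conjSq_of_two_le {n : ℕ} (b : Braid n) {k : Fin n} (hk : 2 ≤ k.1) :
    bifurcatePure (strandPerm n b k) (conjSq b) = conjSq (bifurcate k b) := by
  refine Subtype.ext ?_
  have hs : ∀ l : Fin n, 2 ≤ l.1 → bifurcate l (s n 0) = s (n + 1) 0 := by
    intro l hl
    rw [bifurcate_s (by omega), bifurcateGen, if_neg (by omega), if_neg (by omega),
      if_neg (by omega)]
  have hk' : strandPerm n (s n 0) k = k := by
    ext
    rw [strandPerm_s_val (by omega), posSwap, if_neg (by omega), if_neg (by omega)]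
  simp only [bifurcatePure, conjSq, MonoidHom.coe_mk, OneHom.coe_mk]
  rw [bifurcate_conj _ (sqSubgroup_le_pureBraid n (s_mul_s_mem_sqSubgroup n 0)), bifurcate_mul,
    hk', hs k hk]

/-- Bifurcating one of two strands winding around each other splits the full twist into two. -/
theorem bifurcatePure_conjSq_zero {n : ℕ} (hn : 2 ≤ n) (b : Braid n) :
    bifurcatePure (strandPerm n b ⟨0, by omega⟩) (conjSq b) =
      conjSq (bifurcate ⟨0, by omega⟩ b * s (n + 1) 1) *
        conjSq (bifurcate ⟨0, by omega⟩ b * (s (n + 1) 0 * s (n + 1) 1)) := by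
  refine Subtype.ext ?_
  simp only [bifurcatePure, conjSq, MonoidHom.coe_mk, OneHom.coe_mk, Subgroup.coe_mul]
  have h1 : strandPerm n (s n 0) ⟨0, by omega⟩ = ⟨1, by omega⟩ := by
    ext; rw [strandPerm_s_val (by omega)]; rfl
  have hc := s_succ_eq_conj (n := n + 1) (i := 0) (by omega)
  rw [zero_add] at hc
  rw [bifurcate_conj _ (sqSubgroup_le_pureBraid n (s_mul_s_mem_sqSubgroup n 0)), bifurcate_mul,
    h1, bifurcate_s (by omega), bifurcate_s (by omega)]
  simp only [bifurcateGen, zero_add, lt_self_iff_false, if_true, if_false, Nat.one_ne_zero,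
    Nat.not_lt_zero]
  generalize bifurcate _ b = B
  generalize s (n + 1) 0 = x at *
  generalize s (n + 1) 1 = y at *
  have : x * y * (x * x) * (x * y)⁻¹ = y * y := by
    nth_rw 3 4 [hc]; group
  calc _ = B * (y * (x * x) * y⁻¹ * (y * y)) * B⁻¹ := by group
    _ = _ := by rw [← this]; group

section

variable {A : Type*} [CommGroup A]

/-- In an abelian group, the image of the full twist `conjSq b` depends only on where `b` moves the
first two strands. -/
theorem map_conjSq_eq {n : ℕ} (φ : PureBraid n →* A) (hn : 2 ≤ n) {b c : Braid n}
    (h0 : strandPerm n b ⟨0, by omega⟩ = strandPerm n c ⟨0, by omega⟩)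
    (h1 : strandPerm n b ⟨1, by omega⟩ = strandPerm n c ⟨1, by omega⟩) :
    φ (conjSq b) = φ (conjSq c) := by
  obtain ⟨p, hp, g, hg, hx⟩ := exists_pure_mul_commute hn (x := c⁻¹ * b)
    (by simp [h0])
    (by simp [h1])
  rw [inv_mul_eq_iff_eq_mul] at hx
  have hcp : c * p * c⁻¹ ∈ PureBraid n := (inferInstance : (PureBraid n).Normal).conj_mem _ hp c
  have : conjSq b = ⟨_, hcp⟩ * conjSq c * ⟨_, hcp⟩⁻¹ := by
    refine Subtype.ext ?_
    simp only [conjSq, Subgroup.coe_mul, InvMemClass.coe_inv, hx]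
    have h2 : g * (s n 0 * s n 0) * g⁻¹ = s n 0 * s n 0 := by
      rw [(hg.mul_right hg).eq, mul_inv_cancel_right]
    calc _ = c * p * (g * (s n 0 * s n 0) * g⁻¹) * p⁻¹ * c⁻¹ := by group
      _ = _ := by rw [h2]; group
  rw [this, map_mul, map_mul, map_inv, mul_inv_cancel_comm]

open Classical in
/-- The value of `φ` on the full twists `conjSq b` of the strands in positions `i` and `j`; it
does not depend on `b`, see `linkValue_eq`. It is `1` if there are no such `b`. -/
noncomputable def linkValue {n : ℕ} (φ : PureBraid n →* A) (i j : ℕ) : A :=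
  if h : ∃ b, ∃ hn : 2 ≤ n, (strandPerm n b ⟨0, by omega⟩).1 = i ∧
    (strandPerm n b ⟨1, by omega⟩).1 = j then φ (conjSq h.choose) else 1

theorem linkValue_eq {n : ℕ} (φ : PureBraid n →* A) (hn : 2 ≤ n) (b : Braid n) :
    linkValue φ (strandPerm n b ⟨0, by omega⟩) (strandPerm n b ⟨1, by omega⟩) =
      φ (conjSq b) := by
  have h : ∃ b', ∃ hn : 2 ≤ n, (strandPerm n b' ⟨0, by omega⟩).1 =
      strandPerm n b ⟨0, by omega⟩ ∧ (strandPerm n b' ⟨1, by omega⟩).1 =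
      strandPerm n b ⟨1, by omega⟩ := ⟨b, hn, rfl, rfl⟩
  rw [linkValue, dif_pos h]
  obtain ⟨_, h0, h1⟩ := h.choose_spec
  exact map_conjSq_eq φ hn (Fin.ext h0) (Fin.ext h1)

theorem linkValue_comm {n : ℕ} (φ : PureBraid n →* A) {i j : Fin n} (h : i ≠ j) :
    linkValue φ i j = linkValue φ j i := by
  have hn : 2 ≤ n := by have := Fin.val_ne_of_ne h; omega
  obtain ⟨b, rfl, rfl⟩ := exists_strandPerm_eq h hn
  rw [linkValue_eq φ hn b, ← conjSq_mul_s, ← linkValue_eq φ hn (b * s n 0)]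
  simp only [map_mul, Equiv.Perm.mul_apply]
  congr <;> ext <;> rw [strandPerm_s_val (by omega)] <;> rfl

/-- Bifurcating a strand other than those in positions `i` and `j` only renumbers positions. -/
theorem linkValue_succ_of_ne (φ : ∀ n, PureBraid n →* A)
    (hφ : ∀ n (k : Fin n) (p : PureBraid n), φ (n + 1) (bifurcatePure k p) = φ n p) 
    {n : ℕ} {i j k : Fin n} (h : i ≠ j) (hi : k ≠ i) (hj : k ≠ j) :
    linkValue (φ (n + 1)) (k.castSucc.succAbove i) (k.castSucc.succAbove j) =
      linkValue (φ n) i j := by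
  have hn : 2 ≤ n := by have := Fin.val_ne_of_ne h; omega
  obtain ⟨b, rfl, rfl⟩ := exists_strandPerm_eq h hn
  obtain ⟨k, rfl⟩ := (strandPerm n b).surjective k
  have hk : 2 ≤ k.1 := by
    by_contra hk
    obtain hk | hk : k.1 = 0 ∨ k.1 = 1 := by omega
    · exact hi (congrArg _ (Fin.ext hk))
    · exact hj (congrArg _ (Fin.ext hk))
  rw [linkValue_eq _ hn, ← hφ n (strandPerm n b k), bifurcatePure_conjSq_of_two_le b hk,
    ← linkValue_eq _ (by omega), ← strandPerm_bifurcate, ← strandPerm_bifurcate]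
  have e : ∀ i : Fin n, i.1 < 2 → k.castSucc.succAbove i = i.castSucc := fun i hi =>
    Fin.succAbove_of_castSucc_lt _ _ (by rw [Fin.lt_def]; simp; omega)
  rw [e _ (by simp), e _ (by simp)]
  rfl

/-- Bifurcating the strand in position `i` splits its full twist with the strand in position `j`. -/
theorem linkValue_eq_mul (φ : ∀ n, PureBraid n →* A)
    (hφ : ∀ n (k : Fin n) (p : PureBraid n), φ (n + 1) (bifurcatePure k p) = φ n p) 
    {n : ℕ} {i j : Fin n} (h : i ≠ j) :
    linkValue (φ n) i j = linkValue (φ (n + 1)) i (i.castSucc.succAbove j) *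
      linkValue (φ (n + 1)) (i + 1) (i.castSucc.succAbove j) := by
  have hn : 2 ≤ n := by have := Fin.val_ne_of_ne h; omega
  obtain ⟨b, rfl, rfl⟩ := exists_strandPerm_eq h hn
  rw [linkValue_eq _ hn, ← hφ n (strandPerm n b ⟨0, by omega⟩), bifurcatePure_conjSq_zero hn b,
    map_mul, ← linkValue_eq _ (by omega), ← linkValue_eq _ (by omega)]
  have h0 := strandPerm_bifurcate_castSucc b ⟨0, by omega⟩
  have h1 := strandPerm_bifurcate_succ b ⟨0, by omega⟩
  have h2 := strandPerm_bifurcate b ⟨0, by omega⟩ ⟨1, by omega⟩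
  have v : ∀ {a i c : ℕ} (ha : a < n + 1) (hc : c < n + 1), i + 1 < n + 1 → posSwap i a = c →
      strandPerm (n + 1) (s (n + 1) i) ⟨a, ha⟩ = ⟨c, hc⟩ := by
    rintro a i c ha hc hi rfl
    ext; rw [strandPerm_s_val hi]
  simp only [map_mul, Equiv.Perm.mul_apply]
  rw [v (a := 0) (i := 1) (c := 0) (by omega) (by omega) (by omega) rfl,
    v (a := 1) (i := 1) (c := 2) (by omega) (by omega) (by omega) rfl,
    v (a := 0) (i := 0) (c := 1) (by omega) (by omega) (by omega) rfl,
    v (a := 2) (i := 0) (c := 2) (by omega) (by omega) (by omega) rfl, ← h2]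
  have e2 : (⟨0, by omega⟩ : Fin n).castSucc.succAbove ⟨1, by omega⟩ = ⟨2, by omega⟩ :=
    Fin.succAbove_of_le_castSucc _ _ (by simp)
  rw [e2]
  have e0 := congrArg Fin.val h0
  have e1 := congrArg Fin.val h1
  rw [Fin.val_castSucc] at e0
  rw [Fin.val_succ] at e1
  rw [← e1, ← e0]
  rfl

/-- A family of homomorphisms from the pure braid groups to an abelian group that is invariant under
bifurcation is trivial if it kills the full twist of the outer strands out of three and the full
twist of the inner strands out of four. -/
theorem eq_one_of_linkValue_eq_one (φ : ∀ n, PureBraid n →* A)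
    (hφ : ∀ n (k : Fin n) (p : PureBraid n), φ (n + 1) (bifurcatePure k p) = φ n p) 
    (h3 : linkValue (φ 3) 0 2 = 1) (h4 : linkValue (φ 4) 1 2 = 1) (n : ℕ) : φ n = 1 := by
  -- `β p q r` is the value on two strands with `p` strands to the left of them, `q` strands between
  -- them and `r` strands to the right of them.
  obtain ⟨β, hβ⟩ : ∃ β : ℕ → ℕ → ℕ → A,
      ∀ p q r, β p q r = linkValue (φ (p + q + r + 2)) p (p + q + 1) := ⟨_, fun _ _ _ => rfl⟩
  have eβ : ∀ {p q r n i j}, n = p + q + r + 2 → i = p → j = p + q + 1 →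
      β p q r = linkValue (φ n) i j := by
    rintro p q r _ _ _ rfl rfl rfl
    exact hβ _ _ _
  have d : ∀ {n : ℕ} (k i : Fin n), (k.castSucc.succAbove i).1 =
      if i.1 < k.1 then i.1 else i.1 + 1 := by
    intro n k i
    simp only [Fin.succAbove, Fin.lt_def, Fin.val_castSucc]
    split_ifs <;> simp
  have same : ∀ {p q r k p' q' r'}, k < p + q + r + 2 → k ≠ p → k ≠ p + q + 1 →
      p' + q' + r' = p + q + r + 1 → p' = (if p < k then p else p + 1) →
      p' + q' + 1 = (if p + q + 1 < k then p + q + 1 else p + q + 2) →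
      β p' q' r' = β p q r := by
    intro p q r k p' q' r' hk hkp hkq hn hp hq
    have := linkValue_succ_of_ne φ hφ (n := p + q + r + 2) (i := ⟨p, by omega⟩)
      (j := ⟨p + q + 1, by omega⟩) (k := ⟨k, hk⟩) (by simp; omega) (by simpa using hkp)
      (by simpa using hkq)
    rw [d, d] at this
    rw [eβ (n := p + q + r + 2 + 1) (by omega) hp.symm hq.symm, hβ]
    exact this
  have left : ∀ p q r, β (p + 2) q r = β (p + 1) q r := fun p q r =>
    same (k := 0) (by omega) (by omega) (by omega) (by omega) (by simp) (by simp; omega)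
  have mid : ∀ p q r, β p (q + 2) r = β p (q + 1) r := fun p q r =>
    same (k := p + 1) (by omega) (by omega) (by omega) (by omega) (by simp) (by simp; omega)
  have right : ∀ p q r, β p q (r + 2) = β p q (r + 1) := fun p q r =>
    same (k := p + q + 2) (by omega) (by omega) (by omega) (by omega) (by split_ifs <;> omega)
      (by simp)
  have splitL : ∀ p q r, β p q r = β p (q + 1) r * β (p + 1) q r := by
    intro p q r
    have := linkValue_eq_mul φ hφ (n := p + q + r + 2) (i := ⟨p, by omega⟩)
      (j := ⟨p + q + 1, by omega⟩) (by simp; omega)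
    rw [d] at this
    simp only [show ¬ p + q + 1 < p by omega, if_false] at this
    rw [hβ, this, eβ (n := p + q + r + 2 + 1) (by omega) rfl rfl,
      eβ (n := p + q + r + 2 + 1) (by omega) rfl rfl]
    exact congrArg₂ _ (congrArg _ (by omega)) (congrArg _ (by omega))
  have splitR : ∀ p q r, β p q r = β p q (r + 1) * β p (q + 1) r := by
    intro p q r
    have := linkValue_eq_mul φ hφ (n := p + q + r + 2) (i := ⟨p + q + 1, by omega⟩)
      (j := ⟨p, by omega⟩) (by simp; omega)
    rw [← linkValue_comm _ (by simp; omega)] at this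
    rw [hβ, this, d]
    simp only [show p < p + q + 1 by omega, if_true]
    rw [eβ (n := p + q + r + 2 + 1) (by omega) rfl rfl,
      eβ (n := p + q + r + 2 + 1) (by omega) rfl rfl]
    have c1 := linkValue_comm (φ (p + q + r + 2 + 1)) (i := ⟨p, by omega⟩)
      (j := ⟨p + q + 1, by omega⟩) (by simp; omega)
    have c2 := linkValue_comm (φ (p + q + r + 2 + 1)) (i := ⟨p, by omega⟩)
      (j := ⟨p + q + 1 + 1, by omega⟩) (by simp; omega)
    exact congrArg₂ _ c1.symm c2.symm
  have x101 : β 1 0 1 = 1 := (hβ _ _ _).trans h4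
  have x010 : β 0 1 0 = 1 := (hβ _ _ _).trans h3
  have x111 : β 1 1 1 = 1 := by simpa [left, mid] using splitL 1 1 1
  have x011 : β 0 1 1 = 1 := by simpa [mid, right] using splitR 0 1 1
  have x110 : β 1 1 0 = 1 := by simpa [mid, left] using splitL 1 1 0
  have x001 : β 0 0 1 = 1 := by rw [splitL, x011, x101, one_mul]
  have x100 : β 1 0 0 = 1 := by rw [splitR, x101, x110, one_mul]
  have x000 : β 0 0 0 = 1 := by rw [splitL, x010, x100, one_mul]
  -- Only the vanishing of the three arguments matters, so the eight values above are all values.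
  have all : ∀ p q r, β p q r = 1 := by
    have hp : ∀ p q r, β (p + 1) q r = β 1 q r := by
      intro p q r
      induction p with
      | zero => rfl
      | succ p ih => rw [left, ih]
    have hq : ∀ p q r, β p (q + 1) r = β p 1 r := by
      intro p q r
      induction q with
      | zero => rfl
      | succ q ih => rw [mid, ih]
    have hr : ∀ p q r, β p q (r + 1) = β p q 1 := by
      intro p q r
      induction r with
      | zero => rfl
      | succ r ih => rw [right, ih]
    rintro (_ | p) (_ | q) (_ | r) <;> simp only [hp, hq, hr, x000, x001, x010, x011,
      x100, x101, x110, x111]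
  have link : ∀ i j : Fin n, i < j → linkValue (φ n) i j = 1 := by
    intro i j hij
    rw [← eβ (p := i) (q := j - i - 1) (r := n - j - 1) (by omega) rfl (by omega), all]
  have conj : ∀ b : Braid n, φ n (conjSq b) = 1 := by
    intro b
    by_cases hn : 2 ≤ n
    · rw [← linkValue_eq _ hn]
      have hne : strandPerm n b ⟨0, by omega⟩ ≠ strandPerm n b ⟨1, by omega⟩ :=
        (strandPerm n b).injective.ne (by simp)
      rcases lt_or_gt_of_ne hne with h | h
      · exact link _ _ h
      · rw [linkValue_comm _ hne, link _ _ h]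
    · have : conjSq b = 1 := Subtype.ext (by simp [conjSq, s_of_le (n := n) (i := 0) (by omega)])
      rw [this, map_one]
  have hle : PureBraid n ≤ (φ n).ker.map (PureBraid n).subtype := by
    refine (pureBraid_eq_sqSubgroup n).le.trans ?_
    rw [sqSubgroup, Subgroup.normalClosure, Subgroup.closure_le]
    intro x hx
    obtain ⟨_, rfl, hx⟩ := Group.mem_conjugatesOfSet_iff.1 hx
    obtain ⟨b, rfl⟩ := isConj_iff.1 hx
    exact ⟨conjSq b, conj b, rfl⟩
  ext ⟨p, hp⟩
  obtain ⟨q, hq, hqp⟩ := hle hp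
  obtain rfl : q = ⟨p, hp⟩ := Subtype.ext hqp
  exact hq

end

/-! ### The abelianization of the pure braided Thompson group -/

namespace BTree

open BinaryTree (nil node numLeaves)

/-- The tree with `n + 1` leaves all of whose left subtrees are trivial. -/
def rightVine : ℕ → BTree
  | 0 => nil
  | n + 1 => node () nil (rightVine n)

theorem numLeaves_rightVine (n : ℕ) : (rightVine n).numLeaves = n + 1 := by
  induction n with
  | zero => rfl
  | succ n ih => simp [rightVine, ih]; omega

theorem addCaret_rightVine (n : ℕ) : (rightVine n).addCaret n = rightVine (n + 1) := by
  induction n with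
  | zero => rfl
  | succ n ih => simp [rightVine, addCaret, ih]

theorem eq_nil_or_exists_addCaret (T : BTree) :
    T = nil ∨ ∃ S : BTree, ∃ k < S.numLeaves, T = S.addCaret k := by
  induction T with
  | nil => exact Or.inl rfl
  | node _ l r hl hr =>
    right
    rcases hr with rfl | ⟨S, k, hk, rfl⟩
    · rcases hl with rfl | ⟨S, k, hk, rfl⟩
      · exact ⟨nil, 0, by simp, rfl⟩
      · exact ⟨node () S nil, k, by simp; omega, by simp [addCaret, hk]⟩
    · exact ⟨node () l S, l.numLeaves + k, by simpa using hk, by simp [addCaret]⟩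

end BTree

namespace Fbr

open Diagram BTree

/-- The pure braids on the leaves of a fixed tree `T`, as elements `[T, p, T]`. -/
def pureHom {n : ℕ} (T : BTree) (hT : T.numLeaves = n) : PureBraid n →* Fbr where
  toFun p := mk ⟨n, T, p, T, hT, hT⟩
  map_one' := mk_one T hT
  map_mul' p q := (mk_mul_mk (Comp.mk T p T q T hT hT hT)).symm

/-- The elements `[T, 1, U]`, which form Thompson's group `F`. -/
def treePair {n : ℕ} (T U : BTree) (hT : T.numLeaves = n) (hU : U.numLeaves = n) : Fbr :=
  mk ⟨n, T, 1, U, hT, hU⟩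

theorem treePair_mul_treePair {n : ℕ} {T U W : BTree} (hT : T.numLeaves = n)
    (hU : U.numLeaves = n) (hW : W.numLeaves = n) :
    treePair T U hT hU * treePair U W hU hW = treePair T W hT hW := by
  rw [treePair, treePair, mk_mul_mk (Comp.mk T 1 U 1 W hT hU hW), one_mul, treePair]

theorem treePair_self {n : ℕ} {T : BTree} (hT : T.numLeaves = n) : treePair T T hT hT = 1 :=
  mk_one T hT

theorem pureHom_mul_treePair {n : ℕ} {T U : BTree} (hT : T.numLeaves = n)
    (hU : U.numLeaves = n) (p : PureBraid n) :
    pureHom T hT p * treePair T U hT hU = mk ⟨n, T, p, U, hT, hU⟩ := by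
  change mk ⟨n, T, p, T, hT, hT⟩ * mk ⟨n, T, 1, U, hT, hU⟩ = _
  rw [mk_mul_mk (Comp.mk T p T 1 U hT hT hU), mul_one]

theorem treePair_mul_pureHom {n : ℕ} {T U : BTree} (hT : T.numLeaves = n)
    (hU : U.numLeaves = n) (p : PureBraid n) :
    treePair T U hT hU * pureHom U hU p = mk ⟨n, T, p, U, hT, hU⟩ := by
  change mk ⟨n, T, 1, U, hT, hU⟩ * mk ⟨n, U, p, U, hU, hU⟩ = _
  rw [mk_mul_mk (Comp.mk T 1 U p U hT hU hU), one_mul]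

theorem treePair_addCaret {n k : ℕ} {T U : BTree} (hT : T.numLeaves = n)
    (hU : U.numLeaves = n) (hk : k < n) :
    treePair (T.addCaret k) (U.addCaret k) (by rw [numLeaves_addCaret, hT])
      (by rw [numLeaves_addCaret, hU]) = treePair T U hT hU := by
  rw [treePair, treePair, mk_expands (t := ⟨n, T, 1, U, hT, hU⟩)
    (Relation.ReflTransGen.single ⟨⟨k, hk⟩, rfl⟩)]
  simp only [expand, map_one]

theorem pureHom_bifurcatePure {n : ℕ} {T : BTree} (hT : T.numLeaves = n) (k : Fin n)
    (p : PureBraid n) :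
    pureHom (T.addCaret k) (by rw [numLeaves_addCaret, hT]) (bifurcatePure k p) =
      pureHom T hT p :=
  (mk_expands (t := ⟨n, T, p, T, hT, hT⟩) (Relation.ReflTransGen.single ⟨k, rfl⟩)).symm

variable {A : Type*} [CommGroup A]

/-- In an abelian quotient the element `[T, p, T]` depends only on the pure braid `p`, as
different trees give conjugate elements. -/
theorem map_pureHom_eq (f : Fbr →* A) {n : ℕ} {T U : BTree} (hT : T.numLeaves = n)
    (hU : U.numLeaves = n) (p : PureBraid n) : f (pureHom T hT p) = f (pureHom U hU p) := by
  have := congrArg f ((pureHom_mul_treePair hT hU p).trans (treePair_mul_pureHom hT hU p).symm)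
  rw [map_mul, map_mul, mul_comm] at this
  exact mul_left_cancel this

/-- A homomorphism from Thompson's group `F` to an abelian group is trivial if it kills the two
standard generators. -/
theorem map_treePair_eq_one (f : Fbr →* A)
    (h0 : f (treePair ((rightVine 1).addCaret 0) (rightVine 2) rfl rfl) = 1)
    (h1 : f (treePair ((rightVine 2).addCaret 1) (rightVine 3) rfl rfl) = 1)
    {n : ℕ} {T U : BTree} (hT : T.numLeaves = n) (hU : U.numLeaves = n) :
    f (treePair T U hT hU) = 1 := by
  have hR := numLeaves_rightVine
  have hR' : ∀ n k, ((rightVine n).addCaret k).numLeaves = n + 2 := fun n k => by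
    rw [numLeaves_addCaret, hR]
  -- `e n k` is the factor by which the value of `f` on the pair of a tree with `n + 1` leaves and the
  -- right vine changes when a caret is added at leaf `k`; by `step` it does not depend on the tree.
  obtain ⟨e, he⟩ : ∃ e : ℕ → ℕ → A, ∀ n k,
      e n k = f (treePair ((rightVine n).addCaret k) (rightVine (n + 1)) (hR' n k) (hR _)) :=
    ⟨_, fun _ _ => rfl⟩
  have step : ∀ {n k : ℕ} {T : BTree} (hT : T.numLeaves = n + 1)
      (hT' : (T.addCaret k).numLeaves = n + 2), k ≤ n →
      f (treePair (T.addCaret k) (rightVine (n + 1)) hT' (hR _)) =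
        f (treePair T (rightVine n) hT (hR _)) * e n k := by
    intro n k T hT hT' hk
    rw [← treePair_addCaret hT (hR n) (k := k) (by omega), he, ← map_mul, treePair_mul_treePair]
  have last : ∀ n, e n n = 1 := by
    intro n
    rw [he]
    simp only [addCaret_rightVine, treePair_self, map_one]
  -- Carets added at two different leaves can be added in either order.
  have comm : ∀ n j k, j < k → k ≤ n → e n j * e (n + 1) (k + 1) = e n k * e (n + 1) j := by
    intro n j k hjk hk
    have hc := addCaret_comm (rightVine n) hjk (by rw [hR]; omega)
    have e1 := step (k := k + 1) (hR' n j) (by rw [numLeaves_addCaret, hR']) (by omega)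
    have e2 := step (k := j) (hR' n k) (by rw [numLeaves_addCaret, hR']) (by omega)
    simp only [hc] at e1
    rw [he, he n k, ← e1, e2]
  have stable : ∀ n j, j < n → e (n + 1) j = e n j := by
    intro n j hj
    simpa [last] using (comm n j n hj le_rfl).symm
  have zero : ∀ n, e n 0 = 1 := by
    intro n
    induction n with
    | zero => exact last 0
    | succ n ih =>
      rcases n.eq_zero_or_pos with rfl | hn
      · exact (he 1 0).trans h0
      · rw [stable n 0 hn, ih]
  have one : ∀ n, 1 ≤ n → e n 1 = 1 := by
    intro n hn
    induction n, hn using Nat.le_induction with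
    | base => exact last 1
    | succ n hn ih =>
      obtain rfl | hn := hn.eq_or_lt
      · exact (he 2 1).trans h1
      · rw [stable n 1 hn, ih]
  have all : ∀ n k, k ≤ n → e n k = 1 := by
    intro n
    induction n with
    | zero =>
      intro k hk
      obtain rfl : k = 0 := by omega
      exact zero 0
    | succ n ih =>
      rintro (_ | _ | k) hk
      · exact zero _
      · exact one _ (by omega)
      · simpa [zero, ih (k + 1) (by omega)] using comm n 0 (k + 1) (by omega) (by omega)
  have tree : ∀ n (T : BTree) (hT : T.numLeaves = n + 1),
      f (treePair T (rightVine n) hT (hR n)) = 1 := by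
    intro n
    induction n with
    | zero =>
      intro T hT
      rcases T.eq_nil_or_exists_addCaret with rfl | ⟨S, k, hk, rfl⟩
      · exact (congrArg f (treePair_self rfl)).trans (map_one f)
      · rw [numLeaves_addCaret] at hT
        omega
    | succ n ih =>
      intro T hT
      rcases T.eq_nil_or_exists_addCaret with rfl | ⟨S, k, hk, rfl⟩
      · simp at hT
      · have hS : S.numLeaves = n + 1 := by rw [numLeaves_addCaret] at hT; omega
        rw [step hS hT (by omega), ih S hS, all n k (by omega), one_mul]
  obtain ⟨n, rfl⟩ : ∃ m, n = m + 1 := ⟨n - 1, by have := numLeaves_pos T; omega⟩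
  have := congrArg f (treePair_mul_treePair hT hU (hR n))
  rwa [map_mul, tree, tree, mul_one] at this

/-- The abelianization of the pure braided Thompson group is generated by the images of four
elements, two from Thompson's group `F` and two full twists: a homomorphism to an abelian group that
kills them is trivial. -/
theorem exists_eq_one_of_map_eq_one : ∃ g : Fin 4 → Fbr, ∀ (A : Type) [CommGroup A]
    (f : Fbr →* A), (∀ i, f (g i) = 1) → f = 1 := by
  obtain ⟨b, hb0, hb1⟩ := exists_strandPerm_eq (n := 3) (i := 0) (j := 2) (by decide) (by omega)
  obtain ⟨c, hc0, hc1⟩ := exists_strandPerm_eq (n := 4) (i := 1) (j := 2) (by decide) (by omega)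
  refine ⟨![treePair ((rightVine 1).addCaret 0) (rightVine 2) rfl rfl,
    treePair ((rightVine 2).addCaret 1) (rightVine 3) rfl rfl,
    pureHom (rightVine 2) rfl (conjSq b), pureHom (rightVine 3) rfl (conjSq c)],
    fun A _ f hf => ?_⟩
  have hR := fun n (hn : 0 < n) => (numLeaves_rightVine (n - 1)).trans (Nat.sub_add_cancel hn)
  -- There is no tree without leaves, whence the case distinction.
  obtain ⟨φ, hφ⟩ : ∃ φ : ∀ n, PureBraid n →* A, ∀ n (hn : 0 < n),
      φ n = f.comp (pureHom (rightVine (n - 1)) (hR n hn)) :=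
    ⟨fun n => if hn : 0 < n then f.comp (pureHom (rightVine (n - 1)) (hR n hn)) else 1,
      fun n hn => dif_pos hn⟩
  have hφ' : ∀ {n : ℕ} (T : BTree) (hT : T.numLeaves = n) p, f (pureHom T hT p) = φ n p := by
    intro n T hT p
    rw [hφ n (by have := numLeaves_pos T; omega)]
    exact map_pureHom_eq f _ _ p
  have hφ1 := eq_one_of_linkValue_eq_one φ
    (by
      intro n k p
      rw [hφ n k.pos, MonoidHom.comp_apply, ← pureHom_bifurcatePure _ k, hφ'])
    (by
      have := linkValue_eq (φ 3) (by omega) b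
      rw [hb0, hb1, ← hφ' (n := 3) (rightVine 2) rfl] at this
      exact this.trans (hf 2))
    (by
      have := linkValue_eq (φ 4) (by omega) c
      rw [hc0, hc1, ← hφ' (n := 4) (rightVine 3) rfl] at this
      exact this.trans (hf 3))
  ext x
  induction x using Quotient.ind with | _ t => ?_
  obtain ⟨n, T, p, U, hT, hU⟩ := t
  change f (mk _) = 1
  rw [← pureHom_mul_treePair, map_mul, hφ', hφ1, map_treePair_eq_one f (hf 0) (hf 1), mul_one]
  rfl

end Fbr

/-! ### Linking numbers -/

/-- The number of times the strand in position `j` crosses the strand in position `k` from left to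
right in the standard generator of index `i`. -/
def crossGen (i j k : ℕ) : ℤ := if j = i ∧ k = i + 1 then 1 else 0

theorem crossGen_comm {i j : ℕ} (h : i + 1 < j) (a b : ℕ) :
    crossGen i (posSwap j a) (posSwap j b) + crossGen j a b =
      crossGen j (posSwap i a) (posSwap i b) + crossGen i a b := by
  unfold crossGen posSwap
  grind

theorem crossGen_braid (i a b : ℕ) :
    crossGen i (posSwap (i + 1) (posSwap i a)) (posSwap (i + 1) (posSwap i b)) +
        (crossGen (i + 1) (posSwap i a) (posSwap i b) + crossGen i a b) =
      crossGen (i + 1) (posSwap i (posSwap (i + 1) a)) (posSwap i (posSwap (i + 1) b)) +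
        (crossGen i (posSwap (i + 1) a) (posSwap (i + 1) b) + crossGen (i + 1) a b) := by
  unfold crossGen posSwap
  obtain ha | ha | ha | ha : a = i ∨ a = i + 1 ∨ a = i + 2 ∨ (a ≠ i ∧ a ≠ i + 1 ∧ a ≠ i + 2) := by
    omega
  all_goals
    obtain hb | hb | hb | hb : b = i ∨ b = i + 1 ∨ b = i + 2 ∨
      (b ≠ i ∧ b ≠ i + 1 ∧ b ≠ i + 2) := by omega
  all_goals simp [ha, hb, show i ≠ i + 1 + 1 by omega, show i + 1 + 1 ≠ i by omega]

/-- The permutation `(j, k, z) ↦ (adjSwap i j, adjSwap i k, crossGen i j k + z)`. -/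
def crossAux {n : ℕ} (i : Fin (n - 1)) : Equiv.Perm (Fin n × Fin n × ℤ) where
  toFun x := (adjSwap i x.1, adjSwap i x.2.1, crossGen i x.1 x.2.1 + x.2.2)
  invFun x := (adjSwap i x.1, adjSwap i x.2.1,
    -crossGen i (adjSwap i x.1) (adjSwap i x.2.1) + x.2.2)
  left_inv x := by simp [adjSwap]
  right_inv x := by simp [adjSwap]

/-- The braid group on `n` strands acts on triples `(j, k, z)` by
`b • (j, k, z) = (strandPerm n b j, strandPerm n b k, cross b j k + z)`, see `crossHom_apply`. -/
def crossHom (n : ℕ) : Braid n →* Equiv.Perm (Fin n × Fin n × ℤ) :=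
  PresentedGroup.toGroup (f := crossAux) (lift_rels _
    (by
      intro i j h
      ext x : 1
      refine Prod.ext (Fin.ext ?_) (Prod.ext (Fin.ext ?_) ?_)
      · simpa only [Equiv.Perm.mul_apply, crossAux, Equiv.coe_fn_mk, adjSwap_val] using
          posSwap_comm h _
      · simpa only [Equiv.Perm.mul_apply, crossAux, Equiv.coe_fn_mk, adjSwap_val] using
          posSwap_comm h _
      · simp only [Equiv.Perm.mul_apply, crossAux, Equiv.coe_fn_mk, adjSwap_val, ← add_assoc]
        rw [crossGen_comm h])
    (by
      intro i j h
      ext x : 1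
      refine Prod.ext (Fin.ext ?_) (Prod.ext (Fin.ext ?_) ?_)
      · simpa only [Equiv.Perm.mul_apply, crossAux, Equiv.coe_fn_mk, adjSwap_val, ← h] using
          posSwap_braid _ _
      · simpa only [Equiv.Perm.mul_apply, crossAux, Equiv.coe_fn_mk, adjSwap_val, ← h] using
          posSwap_braid _ _
      · have := congrArg (· + x.2.2) (crossGen_braid i x.1 x.2.1)
        simp only [add_assoc] at this
        simpa only [Equiv.Perm.mul_apply, crossAux, Equiv.coe_fn_mk, adjSwap_val, ← h]
          using this))

/-- The number of crossings of `b`, counted with sign, at which the strand in position `j` at the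
bottom passes over the strand in position `k`; the strand passing from left to right in a standard
generator is taken to be the upper one. For a pure braid this is the linking number of the two
strands. -/
def cross {n : ℕ} (b : Braid n) (j k : Fin n) : ℤ := (crossHom n b (j, k, 0)).2.2

theorem crossHom_s {n i : ℕ} (h : i + 1 < n) (x : Fin n × Fin n × ℤ) :
    crossHom n (s n i) x = (strandPerm n (s n i) x.1, strandPerm n (s n i) x.2.1,
      crossGen i x.1 x.2.1 + x.2.2) := by
  rw [strandPerm_s h]
  unfold s
  rw [dif_pos (by omega)]
  simp only [crossHom, PresentedGroup.toGroup.of]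
  rfl

theorem crossHom_apply {n : ℕ} (b : Braid n) : ∀ (j k : Fin n) (z : ℤ),
    crossHom n b (j, k, z) = (strandPerm n b j, strandPerm n b k, cross b j k + z) := by
  induction b using braid_induction with
  | hs i hi => intro j k z; simp [cross, crossHom_s hi]
  | h1 => simp [cross]
  | hm a b ha hb =>
    intro j k z
    have : cross (a * b) j k = cross a (strandPerm n b j) (strandPerm n b k) + cross b j k := by
      rw [cross, map_mul, Equiv.Perm.mul_apply, hb, ha, add_zero]
    simp only [map_mul, Equiv.Perm.mul_apply, hb, ha, this, add_assoc]
  | hi a ha =>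
    have e : ∀ j k z, (crossHom n a)⁻¹ (j, k, z) = ((strandPerm n a)⁻¹ j, (strandPerm n a)⁻¹ k,
        -cross a ((strandPerm n a)⁻¹ j) ((strandPerm n a)⁻¹ k) + z) := by
      intro j k z
      rw [Equiv.Perm.inv_eq_iff_eq, ha]
      simp
    intro j k z
    simp [cross, e]

theorem cross_s {n i : ℕ} (h : i + 1 < n) (j k : Fin n) : cross (s n i) j k = crossGen i j k := by
  simp [cross, crossHom_s h]

theorem cross_one {n : ℕ} (j k : Fin n) : cross (1 : Braid n) j k = 0 := by
  simp [cross]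

theorem cross_mul {n : ℕ} (a b : Braid n) (j k : Fin n) :
    cross (a * b) j k = cross a (strandPerm n b j) (strandPerm n b k) + cross b j k := by
  rw [cross, map_mul, Equiv.Perm.mul_apply, crossHom_apply, crossHom_apply, add_zero]

theorem cross_inv {n : ℕ} (b : Braid n) (j k : Fin n) :
    cross b⁻¹ j k = -cross b ((strandPerm n b)⁻¹ j) ((strandPerm n b)⁻¹ k) := by
  have := cross_mul b b⁻¹ j k
  rw [mul_inv_cancel, cross_one, map_inv] at this
  omega

theorem predAbove_strandPerm_bifurcate {n : ℕ} (b : Braid n) (k : Fin n) (i : Fin (n + 1)) :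
    (strandPerm n b k).predAbove (strandPerm (n + 1) (bifurcate k b) i) =
      strandPerm n b (k.predAbove i) := by
  by_cases hi : i = k.castSucc
  · rw [hi, strandPerm_bifurcate_castSucc, Fin.predAbove_castSucc_self, Fin.predAbove_castSucc_self]
  · obtain ⟨l, rfl⟩ := Fin.exists_succAbove_eq hi
    rw [strandPerm_bifurcate, Fin.predAbove_succAbove, Fin.predAbove_succAbove]

/-- The two strands into which a strand is bifurcated cross the others as that strand does, and do
not cross each other. -/
theorem cross_bifurcate {n : ℕ} (b : Braid n) : ∀ (k : Fin n) (i j : Fin (n + 1)),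
    cross (bifurcate k b) i j = cross b (k.predAbove i) (k.predAbove j) := by
  induction b using braid_induction with
  | hs l hl =>
    intro k i j
    have e : ∀ i : Fin (n + 1), (k.predAbove i).1 = if i.1 ≤ k.1 then i.1 else i.1 - 1 := by
      intro i
      simp only [Fin.predAbove, Fin.lt_def, Fin.val_castSucc]
      split_ifs <;> first | omega | simp
    have v0 := strandPerm_s_val (n := n + 1) (i := l) (by omega)
    have v1 := strandPerm_s_val (n := n + 1) (i := l + 1) (by omega)
    have c0 := cross_s (n := n + 1) (i := l) (by omega)
    have c1 := cross_s (n := n + 1) (i := l + 1) (by omega)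
    have p0 : ∀ a, posSwap l a = l + 1 ↔ a = l := by unfold posSwap; grind
    have p1 : ∀ a, posSwap l a = l + 2 ↔ a = l + 2 := by unfold posSwap; grind
    have p2 : ∀ a, posSwap (l + 1) a = l ↔ a = l := by unfold posSwap; grind
    have p3 : ∀ a, posSwap (l + 1) a = l + 1 ↔ a = l + 2 := by unfold posSwap; grind
    rw [bifurcate_s hl, cross_s hl]
    unfold bifurcateGen
    split_ifs <;> simp only [cross_mul, v0, v1, c0, c1, crossGen, add_assoc, Nat.reduceAdd, p0, p1,
      p2, p3, e] <;> clear p0 p1 p2 p3 v0 v1 c0 c1 <;> split_ifs <;> omega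
  | h1 => intro k i j; simp [bifurcate_one, cross_one]
  | hm a b ha hb =>
    intro k i j
    rw [bifurcate_mul, cross_mul, ha, hb, cross_mul, predAbove_strandPerm_bifurcate,
      predAbove_strandPerm_bifurcate]
  | hi a ha =>
    intro k i j
    have e : ∀ i, ((strandPerm n a)⁻¹ k).predAbove
        ((strandPerm (n + 1) (bifurcate ((strandPerm n a)⁻¹ k) a))⁻¹ i) =
        (strandPerm n a)⁻¹ (k.predAbove i) := by
      intro i
      rw [eq_comm, Equiv.Perm.inv_eq_iff_eq, ← predAbove_strandPerm_bifurcate]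
      simp
    rw [bifurcate_inv, cross_inv, cross_inv, ha, e, e]

/-! ### Linking numbers of points of the Cantor set -/

namespace BTree

open BinaryTree (nil node numLeaves)

/-- The position of the leaf of `T` whose address is a prefix of the infinite word `x`. -/
def leafIndex : BTree → (ℕ → Bool) → ℕ
  | nil, _ => 0
  | node _ l r, x => if x 0 then l.numLeaves + leafIndex r (fun n => x (n + 1))
      else leafIndex l (fun n => x (n + 1))

theorem leafIndex_lt (T : BTree) (x : ℕ → Bool) : T.leafIndex x < T.numLeaves := by
  induction T generalizing x with
  | nil => simp [leafIndex]
  | node _ l r hl hr =>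
    have h1 := hl fun n => x (n + 1)
    have h2 := hr fun n => x (n + 1)
    simp only [leafIndex, numLeaves]
    split_ifs <;> omega

theorem leafIndex_addCaret (T : BTree) {k : ℕ} (hk : k < T.numLeaves) (x : ℕ → Bool) :
    T.leafIndex x = if (T.addCaret k).leafIndex x ≤ k then (T.addCaret k).leafIndex x
      else (T.addCaret k).leafIndex x - 1 := by
  induction T generalizing x k with
  | nil =>
    simp only [numLeaves, Nat.lt_one_iff] at hk
    subst hk
    simp only [addCaret, leafIndex, numLeaves]
    split_ifs <;> simp_all
  | node _ l r hl hr =>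
    have h1 := leafIndex_lt l fun n => x (n + 1)
    simp only [numLeaves] at hk
    by_cases h : k < l.numLeaves <;> cases hx : x 0 <;>
      simp only [addCaret, h, if_true, if_false, leafIndex, hx, numLeaves_addCaret,
        Bool.false_eq_true]
    · exact hl h _
    · split_ifs <;> omega
    · split_ifs <;> omega
    · rw [hr (k := k - l.numLeaves) (by omega)]
      split_ifs <;> omega

theorem leafIndex_false (T : BTree) : T.leafIndex (fun _ => false) = 0 := by
  induction T with
  | nil => rfl
  | node _ l r hl hr => simp [leafIndex, hl]

theorem leafIndex_true (T : BTree) : T.leafIndex (fun _ => true) + 1 = T.numLeaves := by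
  induction T with
  | nil => rfl
  | node _ l r hl hr => simp only [leafIndex, if_true, numLeaves, ← hr]; omega

/-- The infinite word `x` is a point of the Cantor set fixed by the elements of the
`w`-deferred subgroup: its position among the leaves of a `w`-deferred tree depends only on the
number of leaves. -/
def IsFixedPoint (w : List Bool) (x : ℕ → Bool) : Prop :=
  ∀ A B : BTree, A.numLeaves = B.numLeaves → (graft w A).leafIndex x = (graft w B).leafIndex x

/-- The fixed points occupy all the leaves of the tree with a single caret below the vertex with
address `w`. -/
theorem exists_isFixedPoint (w : List Bool) {k : ℕ} (hk : k < w.length + 2) :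
    ∃ x, IsFixedPoint w x ∧ (graft w (node () nil nil)).leafIndex x = k := by
  induction w generalizing k with
  | nil =>
    obtain rfl | rfl : k = 0 ∨ k = 1 := by simp at hk; omega
    · exact ⟨fun _ => false, fun A B _ => by simp [leafIndex_false], leafIndex_false _⟩
    · refine ⟨fun _ => true, fun A B h => ?_, rfl⟩
      have h1 := leafIndex_true A
      have h2 := leafIndex_true B
      simp only [graft]
      omega
  | cons b w ih =>
    have hn : (graft w (node () nil nil)).numLeaves = w.length + 2 := by
      rw [numLeaves_graft]; simp; omega
    simp only [List.length_cons] at hk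
    cases b
    · by_cases h : k < w.length + 2
      · obtain ⟨x, hx, hxk⟩ := ih h
        exact ⟨fun n => n.casesOn false x,
          fun A B hAB => by simpa [graft, leafIndex] using hx A B hAB,
          by simpa [graft, leafIndex] using hxk⟩
      · refine ⟨fun _ => true, fun A B hAB => ?_, ?_⟩
        · simp [graft, leafIndex, numLeaves_graft, hAB]
        · simp only [graft, leafIndex, if_true, hn]; omega
    · rcases k with _ | k
      · exact ⟨fun _ => false, fun A B hAB => by simp [graft, leafIndex],
          by simp [graft, leafIndex]⟩
      · obtain ⟨x, hx, hxk⟩ := ih (k := k) (by omega)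
        refine ⟨fun n => n.casesOn true x, fun A B hAB => ?_, ?_⟩
        · simpa [graft, leafIndex] using hx A B hAB
        · change 1 + (graft w _).leafIndex x = k + 1
          rw [hxk, add_comm]

end BTree

open BTree

/-- The linking number of the strands of a triple that end at the leaves below which the points `x`
and `y` of the Cantor set lie; it is `0` if they are the same strand. -/
def Diagram.link (t : Diagram) (x y : ℕ → Bool) : ℤ :=
  cross t.braid.1 ⟨t.bot.leafIndex x, (leafIndex_lt _ _).trans_eq t.bot_leaves⟩
    ⟨t.bot.leafIndex y, (leafIndex_lt _ _).trans_eq t.bot_leaves⟩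

theorem Diagram.link_expand (t : Diagram) (k : Fin t.n) (x y : ℕ → Bool) :
    (t.expand k).link x y = t.link x y := by
  have e₀ : ∀ a h, (k.predAbove ⟨a, h⟩).1 = if a ≤ k.1 then a else a - 1 := by
    intro a h
    simp only [Fin.predAbove, Fin.lt_def, Fin.val_castSucc]
    split_ifs <;> first | omega | simp
  have e : ∀ z h h', k.predAbove ⟨(t.expand k).bot.leafIndex z, h⟩ = ⟨t.bot.leafIndex z, h'⟩ := by
    intro z h h'
    ext
    exact (e₀ _ _).trans (leafIndex_addCaret t.bot (k.2.trans_eq t.bot_leaves.symm) z).symm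
  exact (cross_bifurcate t.braid.1 k _ _).trans (congrArg₂ _ (e _ _ _) (e _ _ _))

theorem Diagram.Expands.link_eq {t t' : Diagram} (h : Expands t t') (x y : ℕ → Bool) :
    t'.link x y = t.link x y := by
  induction h with
  | refl => rfl
  | tail _ h ih =>
    obtain ⟨k, rfl⟩ := h
    rw [link_expand, ih]

/-- The linking number of two points of the Cantor set in an element of the pure braided Thompson
group. -/
def Fbr.link (x y : ℕ → Bool) : Fbr → ℤ :=
  Quotient.lift (fun t : Diagram => t.link x y) fun a b h => by
    obtain ⟨u, h1, h2⟩ := Diagram.equiv_iff.1 h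
    exact (h1.link_eq x y).symm.trans (h2.link_eq x y)

/-- Two elements of the `w`-deferred subgroup are represented by composable triples of `w`-deferred
trees. -/
theorem exists_eq_mk_graft {w : List Bool} {x y : Fbr} (hx : x ∈ FbrDeferred w)
    (hy : y ∈ FbrDeferred w) : ∃ (n : ℕ) (A B C : BTree) (p q : PureBraid n)
      (hA : (graft w A).numLeaves = n) (hB : (graft w B).numLeaves = n)
      (hC : (graft w C).numLeaves = n), x = Fbr.mk ⟨n, graft w A, p, graft w B, hA, hB⟩ ∧
        y = Fbr.mk ⟨n, graft w B, q, graft w C, hB, hC⟩ := by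
  obtain ⟨a, h1, h2, rfl⟩ := hx
  obtain ⟨b, h3, h4, rfl⟩ := hy
  obtain ⟨A, hA⟩ := isDeferred_iff.1 h1
  obtain ⟨B, hB⟩ := isDeferred_iff.1 h2
  obtain ⟨C, hC⟩ := isDeferred_iff.1 h3
  obtain ⟨D, hD⟩ := isDeferred_iff.1 h4
  obtain ⟨R, hR1, hR2⟩ := exists_refines B C
  obtain ⟨a', A', ha, hA', hB'⟩ := exists_expands_graft w hA hB hR1
  obtain ⟨b', D', hb, hD', hC'⟩ := exists_expands_graft w (t := b.inv) hD hC hR2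
  replace hb := hb.inv
  rw [Diagram.inv_inv] at hb
  rw [Fbr.mk_expands ha, Fbr.mk_expands hb]
  obtain ⟨n, T, p, U, hT, hU⟩ := a'
  obtain ⟨m, W, q, V, hW, hV⟩ := b'
  obtain rfl : T = graft w A' := hA'
  obtain rfl : U = graft w R := hB'
  obtain rfl : W = graft w D' := hD'
  obtain rfl : V = graft w R := hC'
  obtain rfl : m = n := hV.symm.trans hU
  exact ⟨m, A', R, D', p, q⁻¹, hT, hU, hW, rfl, rfl⟩

/-- Linking numbers of arbitrary points form a cocycle; at fixed points it is a homomorphism. -/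
theorem link_mul {w : List Bool} {x y : ℕ → Bool} (hx : IsFixedPoint w x) (hy : IsFixedPoint w y)
    {a b : Fbr} (ha : a ∈ FbrDeferred w) (hb : b ∈ FbrDeferred w) :
    Fbr.link x y (a * b) = Fbr.link x y a + Fbr.link x y b := by
  obtain ⟨n, A, B, C, p, q, hA, hB, hC, rfl, rfl⟩ := exists_eq_mk_graft ha hb
  rw [Fbr.mk_mul_mk (Diagram.Comp.mk _ p _ q _ hA hB hC)]
  have hBC : B.numLeaves = C.numLeaves := by
    rw [numLeaves_graft] at hB hC
    omega
  change cross (p.1 * q.1) _ _ = cross p.1 _ _ + cross q.1 _ _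
  rw [cross_mul, MonoidHom.mem_ker.1 q.2]
  simp only [hx B C hBC, hy B C hBC, Equiv.Perm.one_apply]

/-- The linking number of two fixed points as a homomorphism on the `w`-deferred subgroup. -/
noncomputable def linkHom {w : List Bool} {x y : ℕ → Bool} (hx : IsFixedPoint w x)
    (hy : IsFixedPoint w y) : FbrDeferred w →* Multiplicative ℤ :=
  MonoidHom.mk' (fun a => Multiplicative.ofAdd (Fbr.link x y a)) fun a b =>
    congrArg Multiplicative.ofAdd (link_mul hx hy a.2 b.2)

/-! ### Comparing abelianizations -/

/-- The linking numbers of five pairs among the first five strands take independent values on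
suitable pure braids. -/
theorem eq_zero_of_sum_cross_eq_zero {n : ℕ} (hn : 5 ≤ n) {c : Fin 5 → ℚ}
    (h : ∀ p ∈ PureBraid n, ∑ i, c i *
      (cross p ⟨![0, 1, 2, 3, 0] i, by fin_cases i <;> simp <;> omega⟩
        ⟨![1, 2, 3, 4, 2] i, by fin_cases i <;> simp <;> omega⟩ : ℚ) = 0) : c = 0 := by
  have hs := fun i => sqSubgroup_le_pureBraid n (s_mul_s_mem_sqSubgroup n i)
  have v0 := strandPerm_s_val (n := n) (i := 0) (by omega)
  have v1 := strandPerm_s_val (n := n) (i := 1) (by omega)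
  have v2 := strandPerm_s_val (n := n) (i := 2) (by omega)
  have v3 := strandPerm_s_val (n := n) (i := 3) (by omega)
  have c0 := cross_s (n := n) (i := 0) (by omega)
  have c1 := cross_s (n := n) (i := 1) (by omega)
  have c2 := cross_s (n := n) (i := 2) (by omega)
  have c3 := cross_s (n := n) (i := 3) (by omega)
  have h0 := h _ (hs 0)
  have h1 := h _ (hs 1)
  have h2 := h _ (hs 2)
  have h3 := h _ (hs 3)
  -- The pure braid `s 1 * s 0 * s 0 * s 1` winds the strand `2` around the strands `0` and `1`.
  have h4 := h _ (mul_mem ((inferInstance : (PureBraid n).Normal).conj_mem _ (hs 0) (s n 1)) (hs 1))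
  rw [← mul_assoc, inv_mul_cancel_right] at h4
  simp only [Fin.sum_univ_five, cross_mul, map_mul, Equiv.Perm.mul_apply, v0, v1, v2, v3, c0, c1,
    c2, c3] at h0 h1 h2 h3 h4
  simp [crossGen, posSwap] at h0 h1 h2 h3 h4
  ext i
  fin_cases i <;> simp_all

/-- For `w` of length at least `3`, the `w`-deferred subgroup has five independent homomorphisms to
`ℤ`, so that its abelianization is not generated by four elements. -/
theorem not_surjective {w : List Bool} (hw : 3 ≤ w.length) (π : Fbr →* FbrDeferred w) :
    ¬ Function.Surjective π := by
  intro hπ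
  obtain ⟨g, hg⟩ := Fbr.exists_eq_one_of_map_eq_one
  have hpt : ∀ k : Fin 5, ∃ x, IsFixedPoint w x ∧
      (graft w (.node () .nil .nil)).leafIndex x = k :=
    fun k => exists_isFixedPoint w (by omega)
  choose x hx hxk using hpt
  obtain ⟨χ, hχ⟩ : ∃ χ : Fin 5 → FbrDeferred w →* Multiplicative ℤ, ∀ i, χ i =
      linkHom (hx (![0, 1, 2, 3, 0] i)) (hx (![1, 2, 3, 4, 2] i)) := ⟨_, fun _ => rfl⟩
  -- There are fewer elements `g j` than homomorphisms `χ i`, so some nontrivial combination of the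
  -- latter vanishes on `π (g j)` for all `j`.
  have hdim : Module.finrank ℚ (Fin 4 → ℚ) < Module.finrank ℚ (Fin 5 → ℚ) := by simp
  obtain ⟨c, hc, hc0⟩ := (Submodule.ne_bot_iff _).1 (LinearMap.ker_ne_bot_of_finrank_lt
    (f := Matrix.mulVecLin (Matrix.of fun (j : Fin 4) (i : Fin 5) =>
      ((χ i (π (g j))).toAdd : ℚ))) hdim)
  refine hc0 (eq_zero_of_sum_cross_eq_zero (n := w.length + 2) (by omega) fun p hp => ?_)
  obtain ⟨f, hf⟩ : ∃ f : Fbr →* Multiplicative ℚ, ∀ a, (f a).toAdd =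
      ∑ i, c i * ((χ i (π a)).toAdd : ℚ) :=
    ⟨MonoidHom.mk' (fun a => Multiplicative.ofAdd (∑ i, c i * ((χ i (π a)).toAdd : ℚ)))
      fun a b => by
        rw [← ofAdd_add, ← Finset.sum_add_distrib]
        simp [mul_add], fun _ => rfl⟩
  have hf1 : f = 1 := hg _ f fun j => by
    have := congrFun (LinearMap.mem_ker.1 hc) j
    refine Multiplicative.toAdd.injective ((hf _).trans ?_)
    simpa [Matrix.mulVec, dotProduct, mul_comm] using this
  have hT : (graft w (.node () .nil .nil)).numLeaves = w.length + 2 := by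
    rw [numLeaves_graft]; simp; omega
  obtain ⟨a, ha⟩ := hπ ⟨Fbr.mk ⟨_, _, ⟨p, hp⟩, _, hT, hT⟩, _,
    isDeferred_iff.2 ⟨_, rfl⟩, isDeferred_iff.2 ⟨_, rfl⟩, rfl⟩
  have := hf a
  rw [hf1, ha] at this
  refine Eq.trans (Finset.sum_congr rfl fun i _ => ?_) this.symm
  rw [hχ]
  congr 2
  refine congrArg₂ (cross p) (Fin.ext ?_) (Fin.ext ?_)
  · simp only [hxk]
    fin_cases i <;> rfl
  · simp only [hxk]
    fin_cases i <;> rfl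

end BraidedThompson

theorem mainTheorem8 (w : List Bool) (hw : 3 ≤ w.length) :
    IsEmpty (BraidedThompson.FbrDeferred w ≃* BraidedThompson.Fbr) ∧
      ∀ (N : Subgroup BraidedThompson.Fbr) [N.Normal],
        IsEmpty (BraidedThompson.FbrDeferred w ≃* BraidedThompson.Fbr ⧸ N) := by
  refine ⟨⟨fun e => ?_⟩, fun N _ => ⟨fun e => ?_⟩⟩
  · exact BraidedThompson.not_surjective hw e.symm.toMonoidHom e.symm.surjective
  · exact BraidedThompson.not_surjective hw (e.symm.toMonoidHom.comp (QuotientGroup.mk' N))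
      (e.symm.surjective.comp (QuotientGroup.mk'_surjective N))
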